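/- For every $n\in\mathbb N$ let $\rho_n,\sigma_n$ be density operators on a finite-dimensional Hilbert space $\mathcal H_n$ with $\operatorname{supp}\rho_n\subseteq\operatorname{supp}\sigma_n$. Powers of positive semidefinite operators are taken on their supports and are $0$ on the orthocomplement, and $\log 0:=-\infty$. Let $\widehat\rho_n:=\sum_i P_i\rho_nP_i$ be the pinching of $\rho_n$ by $\sigma_n$, where the $P_i$ are the spectral projections of $\sigma_n$ belonging to its different eigenvalues. For $\alpha>1$ put $$\overline\psi(\alpha):=\limsup_{n\to\infty}\tfrac1n\log\operatorname{Tr}\bigl(\rho_n^{1/2}\sigma_n^{(1-\alpha)/\alpha}\rho_n^{1/2}\bigr)^{\alpha},\qquad \widehat\psi(\alpha):=\limsup_{n\to\infty}\tfrac1n\log\operatorname{Tr}\widehat\rho_n^{\,\alpha}\sigma_n^{1-\alpha},$$ and let $\widehat D_1:=\inf_{\alpha>1}\frac{\widehat\psi(\alpha)}{\alpha-1}$, $\widehat D_\infty:=\sup_{\alpha>1}\frac{\widehat\psi(\alpha)}{\alpha-1}$. For $a,r\in\mathbb R$ put $$\widehat\phi(a):=\sup_{\alpha>1}\{a(\alpha-1)-\widehat\psi(\alpha)\},\qquad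 H_r^*:=\sup_{\alpha>1}\frac{r(\alpha-1)-\overline\psi(\alpha)}{\alpha},\qquad \widehat H_r^*:=\sup_{\alpha>1}\frac{r(\alpha-1)-\widehat\psi(\alpha)}{\alpha}.$$ All these quantities take values in $[-\infty,+\infty]$. Let $\widehat S_n(a):=\{\widehat\rho_n-e^{na}\sigma_n>0\}$ be the spectral projection of $\widehat\rho_n-e^{na}\sigma_n$ onto its positive eigenvalues, and for $r\ge0$ let the strong converse exponent be $$sc(r):=\inf\Bigl\{-\liminf_{n\to\infty}\tfrac1n\log\operatorname{Tr}\rho_nT_n\ :\ \limsup_{n\to\infty}\tfrac1n\log\operatorname{Tr}\sigma_nT_n\le -r\Bigr\},$$ the infimum being over all sequences of operators $0\le T_n\le I$ on $\mathcal H_n$. Assume that for every $\alpha>1$ the limsup defining $\widehat\psi(\alpha)$ is a limit, and that $\widehat\psi$ is real-valued and differentiable on $(1,+\infty)$. Then for every real $a$ with $\widehat D_1<a<\widehat D_\infty$, $$\lim_{n\to\infty}\tfrac1n\log\operatorname{Tr}\sigma_n\widehat S_n(a)=-(\widehat\phi(a)+a),\qquad \lim_{n\to\infty}\tfrac1n\log\operatorname{Tr}\rho_n\widehat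 S_n(a)=-\widehat\phi(a),$$ and $$H_r^*\le sc(r)\le\widehat H_r^*\qquad\text{for all } r\ge0.$$ If, moreover, $\overline\psi(\alpha)=\widehat\psi(\alpha)$ for every $\alpha>1$, then $sc(r)=H_r^*$ for all $r\ge0$. -/

import Mathlib

open Filter Topology
open scoped ComplexOrder

noncomputable section

/-! Finite-dimensional quantum hypothesis testing. Operators on the Hilbert space `ℂ^ι` (`ι` a finite
type) are complex matrices indexed by `ι`. -/

namespace QHT

section SingleSystem

variable {ι : Type*} [Fintype ι] [DecidableEq ι]

/-- `ρ` is a density operator (state). -/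
def IsState (ρ : Matrix ι ι ℂ) : Prop :=
  ρ.PosSemidef ∧ ρ.trace = 1

/-- `T` is a test: `0 ≤ T ≤ I`. -/
def IsTest (T : Matrix ι ι ℂ) : Prop :=
  T.PosSemidef ∧ (1 - T).PosSemidef

/-- The support of a positive semidefinite operator, which is its range. -/
def supp (A : Matrix ι ι ℂ) : Submodule ℂ (ι → ℂ) :=
  LinearMap.range A.mulVecLin

/-- The spectral projection of a Hermitian operator for the eigenvalues lying in `S`. -/
def specProj (A : Matrix ι ι ℂ) (S : Set ℝ) : Matrix ι ι ℂ :=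
  cfc (S.indicator (fun _ : ℝ => (1 : ℝ))) A

/-- The power `A ^ t` of a positive semidefinite operator, taken on the support of `A` and
equal to `0` on its orthocomplement (for every real `t`). -/
def suppPow (A : Matrix ι ι ℂ) (t : ℝ) : Matrix ι ι ℂ :=
  cfc (fun x : ℝ => if 0 < x then x ^ t else 0) A

/-- The pinching `X ↦ ∑ P_i X P_i`, where the `P_i` are the spectral projections of `σ`
belonging to its different eigenvalues. -/
def pinching (σ X : Matrix ι ι ℂ) : Matrix ι ι ℂ :=
  ∑ x ∈ (Matrix.finite_real_spectrum (A := σ)).toFinset, specProj σ {x} * X * specProj σ {x}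

/-- The (real) trace `Tr A`, used for operators whose trace is real. -/
def tr (A : Matrix ι ι ℂ) : ℝ := A.trace.re

/-- `Q_t(ρ‖σ) = Tr ρ^t σ^{1-t}`. -/
def Q (t : ℝ) (ρ σ : Matrix ι ι ℂ) : ℝ :=
  tr (suppPow ρ t * suppPow σ (1 - t))

/-- `Q*_t(ρ‖σ) = Tr (ρ^{1/2} σ^{(1-t)/t} ρ^{1/2})^t`. -/
def Qstar (t : ℝ) (ρ σ : Matrix ι ι ℂ) : ℝ :=
  tr (suppPow (suppPow ρ (1 / 2) * suppPow σ ((1 - t) / t) * suppPow ρ (1 / 2)) t)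

end SingleSystem

/-- `(1/n) log (u n)` in the extended reals, with `log 0 = -∞`. -/
def logRate (u : ℕ → ℝ) (n : ℕ) : EReal :=
  ENNReal.log (ENNReal.ofReal (u n)) / ((n : ℝ) : EReal)

/-- `f_∘(a) = sup_{t>1} {a (t-1) - f(t)}`. -/
def polar (f : ℝ → EReal) (a : ℝ) : EReal :=
  ⨆ t ∈ Set.Ioi (1 : ℝ), (((a * (t - 1) : ℝ) : EReal) - f t)

/-- `H*_{f,r} = sup_{t>1} (r (t-1) - f(t)) / t`. -/
def antiDiv (f : ℝ → EReal) (r : ℝ) : EReal :=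
  ⨆ t ∈ Set.Ioi (1 : ℝ), (((r * (t - 1) : ℝ) : EReal) - f t) / (t : EReal)

section Sequences

variable {ι : ℕ → Type*} [∀ n, Fintype (ι n)] [∀ n, DecidableEq (ι n)]

/-- The sequence `(1/n) ψ(α|ρ̂_n‖σ_n)`, where `ρ̂_n` is the pinching of `ρ_n` by `σ_n`. -/
def psiHatSeq (ρ σ : ∀ n, Matrix (ι n) (ι n) ℂ) (α : ℝ) : ℕ → EReal :=
  logRate (fun n => Q α (pinching (σ n) (ρ n)) (σ n))

/-- `ψ̂(α|ρ‖σ)`. -/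
def psiHat (ρ σ : ∀ n, Matrix (ι n) (ι n) ℂ) (α : ℝ) : EReal :=
  limsup (psiHatSeq ρ σ α) atTop

/-- `ψ̄(α|ρ‖σ)`. -/
def psiBar (ρ σ : ∀ n, Matrix (ι n) (ι n) ℂ) (α : ℝ) : EReal :=
  limsup (logRate (fun n => Qstar α (ρ n) (σ n))) atTop

/-- `D̂_α(ρ‖σ)` for `α > 1`. -/
def DHat (ρ σ : ∀ n, Matrix (ι n) (ι n) ℂ) (α : ℝ) : EReal :=
  psiHat ρ σ α / ((α - 1 : ℝ) : EReal)

/-- `D̂_1(ρ‖σ)`. -/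
def DHatOne (ρ σ : ∀ n, Matrix (ι n) (ι n) ℂ) : EReal :=
  ⨅ α ∈ Set.Ioi (1 : ℝ), DHat ρ σ α

/-- `D̂_∞(ρ‖σ)`. -/
def DHatInfty (ρ σ : ∀ n, Matrix (ι n) (ι n) ℂ) : EReal :=
  ⨆ α ∈ Set.Ioi (1 : ℝ), DHat ρ σ α

/-- `φ̂(a)`. -/
def phiHat (ρ σ : ∀ n, Matrix (ι n) (ι n) ℂ) (a : ℝ) : EReal :=
  polar (psiHat ρ σ) a

/-- The Hoeffding anti-divergence `H*_r(ρ‖σ)`. -/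
def H (ρ σ : ∀ n, Matrix (ι n) (ι n) ℂ) (r : ℝ) : EReal :=
  antiDiv (psiBar ρ σ) r

/-- The pinched Hoeffding anti-divergence `Ĥ*_r(ρ‖σ)`. -/
def HHat (ρ σ : ∀ n, Matrix (ι n) (ι n) ℂ) (r : ℝ) : EReal :=
  antiDiv (psiHat ρ σ) r

/-- The pinched Neyman-Pearson test `Ŝ_n(a) = {ρ̂_n - e^{na} σ_n > 0}`. -/
def SHat (ρ σ : ∀ n, Matrix (ι n) (ι n) ℂ) (a : ℝ) (n : ℕ) : Matrix (ι n) (ι n) ℂ :=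
  specProj (pinching (σ n) (ρ n) - Real.exp (n * a) • σ n) (Set.Ioi 0)

/-- The strong converse exponent: the infimum of `-liminf (1/n) log Tr ρ_n T_n` over all
sequences of tests with `limsup (1/n) log Tr σ_n T_n ≤ -r`. -/
def sc (ρ σ : ∀ n, Matrix (ι n) (ι n) ℂ) (r : ℝ) : EReal :=
  sInf {x : EReal | ∃ T : ∀ n, Matrix (ι n) (ι n) ℂ, (∀ n, IsTest (T n)) ∧
    limsup (logRate (fun n => tr (σ n * T n))) atTop ≤ ((-r : ℝ) : EReal) ∧
    x = -liminf (logRate (fun n => tr (ρ n * T n))) atTop}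

end Sequences

end QHT

end

noncomputable section

namespace QHT

section Diagonalization

variable {ι : Type*} [Fintype ι] [DecidableEq ι]

/-- The operators that are diagonal with real entries in the orthonormal basis formed by the
columns of the unitary `U`. -/
def conjDiag (U : Matrix.unitaryGroup ι ℂ) : (ι → ℝ) →⋆ₐ[ℝ] Matrix ι ι ℂ where
  toFun d := (U : Matrix ι ι ℂ) * Matrix.diagonal (fun i => (d i : ℂ)) * star (U : Matrix ι ι ℂ)
  map_one' := by simp
  map_mul' d e := by
    have h : star (U : Matrix ι ι ℂ) * (U : Matrix ι ι ℂ) = 1 := Unitary.coe_star_mul_self U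
    calc _ = (U : Matrix ι ι ℂ) * (Matrix.diagonal (fun i => (d i : ℂ)) *
            Matrix.diagonal (fun i => (e i : ℂ))) * star (U : Matrix ι ι ℂ) := by
            simp
      _ = (U : Matrix ι ι ℂ) * (Matrix.diagonal (fun i => (d i : ℂ)) *
            (star (U : Matrix ι ι ℂ) * (U : Matrix ι ι ℂ)) *
            Matrix.diagonal (fun i => (e i : ℂ))) * star (U : Matrix ι ι ℂ) := by
            rw [h, mul_one]
      _ = _ := by simp only [mul_assoc]
  map_zero' := by simp
  map_add' d e := by
    simp [← Matrix.diagonal_add, mul_add, add_mul]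
  commutes' r := by
    have h : (Matrix.diagonal (fun i : ι => ((algebraMap ℝ (ι → ℝ) r) i : ℂ))) =
        (r : ℂ) • (1 : Matrix ι ι ℂ) := by
      rw [Matrix.smul_one_eq_diagonal]; rfl
    rw [h]
    simp [Algebra.algebraMap_eq_smul_one]
  map_star' d := by
    simp only [star_mul, star_star, mul_assoc]
    congr 2
    rw [Matrix.star_eq_conjTranspose, Matrix.diagonal_conjTranspose]
    congr 1
    ext i
    simp

variable (U : Matrix.unitaryGroup ι ℂ)

theorem conjDiag_apply (d : ι → ℝ) : conjDiag U d =
    (U : Matrix ι ι ℂ) * Matrix.diagonal (fun i => (d i : ℂ)) * star (U : Matrix ι ι ℂ) := rfl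

theorem isHermitian_conjDiag (d : ι → ℝ) : (conjDiag U d).IsHermitian := by
  have h : star (conjDiag U d) = conjDiag U d := by
    rw [← map_star]; congr 1
  exact h

theorem posSemidef_conjDiag {d : ι → ℝ} (hd : ∀ i, 0 ≤ d i) : (conjDiag U d).PosSemidef := by
  rw [conjDiag_apply, Matrix.star_eq_conjTranspose]
  refine Matrix.PosSemidef.mul_mul_conjTranspose_same ?_ _
  rw [Matrix.posSemidef_diagonal_iff]
  intro i
  exact_mod_cast hd i

theorem aeval_conjDiag (P : Polynomial ℝ) (d : ι → ℝ) :
    Polynomial.aeval (conjDiag U d) P = conjDiag U (fun i => P.eval (d i)) := by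
  rw [Polynomial.aeval_algHom_apply (conjDiag U)]
  congr 1
  ext i
  simp

theorem spectrum_conjDiag_subset (d : ι → ℝ) : spectrum ℝ (conjDiag U d) ⊆ Set.range d := by
  refine (AlgHom.spectrum_apply_subset (conjDiag U) d).trans ?_
  rw [Pi.spectrum_eq]
  intro x hx
  simp only [Set.mem_iUnion] at hx
  obtain ⟨i, hi⟩ := hx
  refine ⟨i, ?_⟩
  have : d i = algebraMap ℝ ℝ (d i) := rfl
  rw [this, spectrum.scalar_eq] at hi
  exact hi.symm

theorem cfc_conjDiag (f : ℝ → ℝ) (d : ι → ℝ) :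
    cfc f (conjDiag U d) = conjDiag U (fun i => f (d i)) := by
  classical
  obtain ⟨P, hP⟩ : ∃ P : Polynomial ℝ, ∀ i, P.eval (d i) = f (d i) := by
    refine ⟨Lagrange.interpolate (Finset.univ.image d) id f, fun i => ?_⟩
    have := Lagrange.eval_interpolate_at_node (s := Finset.univ.image d) (v := id) f
      (Function.injective_id.injOn) (Finset.mem_image_of_mem d (Finset.mem_univ i))
    simpa using this
  have h1 : cfc f (conjDiag U d) = cfc P.eval (conjDiag U d) := by
    refine cfc_congr fun x hx => ?_
    obtain ⟨i, rfl⟩ := spectrum_conjDiag_subset U d hx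
    exact (hP i).symm
  have h2 : IsSelfAdjoint (conjDiag U d) := isHermitian_conjDiag U d
  rw [h1, cfc_polynomial P (conjDiag U d) h2, aeval_conjDiag]
  simp only [hP]

theorem exists_eq_conjDiag {A : Matrix ι ι ℂ} (hA : A.IsHermitian) :
    ∃ V : Matrix.unitaryGroup ι ℂ, A = conjDiag V hA.eigenvalues := by
  refine ⟨hA.eigenvectorUnitary, ?_⟩
  conv_lhs => rw [hA.spectral_theorem, Unitary.conjStarAlgAut_apply]
  rfl

theorem exists_eq_conjDiag_of_posSemidef {A : Matrix ι ι ℂ} (hA : A.PosSemidef) :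
    ∃ (V : Matrix.unitaryGroup ι ℂ) (d : ι → ℝ), (∀ i, 0 ≤ d i) ∧ A = conjDiag V d := by
  obtain ⟨V, hV⟩ := exists_eq_conjDiag hA.1
  exact ⟨V, _, hA.eigenvalues_nonneg, hV⟩

/-- The diagonal entries of `X` in the basis formed by the columns of `U`. -/
def diagIn (X : Matrix ι ι ℂ) (i : ι) : ℝ :=
  ((star (U : Matrix ι ι ℂ) * X * (U : Matrix ι ι ℂ)) i i).re

theorem tr_mul_conjDiag (X : Matrix ι ι ℂ) (d : ι → ℝ) :
    tr (X * conjDiag U d) = ∑ i, diagIn U X i * d i := by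
  have h : (X * conjDiag U d).trace =
      (star (U : Matrix ι ι ℂ) * X * (U : Matrix ι ι ℂ) *
        Matrix.diagonal (fun i => (d i : ℂ))).trace := by
    rw [conjDiag_apply, ← mul_assoc, Matrix.trace_mul_comm]
    simp only [mul_assoc]
  unfold tr diagIn
  rw [h, Matrix.trace, Complex.re_sum]
  refine Finset.sum_congr rfl fun i _ => ?_
  rw [Matrix.diag_apply, Matrix.mul_diagonal]
  simp

theorem diagIn_conjDiag (d : ι → ℝ) (i : ι) : diagIn U (conjDiag U d) i = d i := by
  have h : star (U : Matrix ι ι ℂ) * (U : Matrix ι ι ℂ) = 1 := Unitary.coe_star_mul_self U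
  have : star (U : Matrix ι ι ℂ) * (conjDiag U d) * (U : Matrix ι ι ℂ) =
      Matrix.diagonal (fun i => (d i : ℂ)) := by
    rw [conjDiag_apply]
    calc _ = (star (U : Matrix ι ι ℂ) * (U : Matrix ι ι ℂ)) *
          Matrix.diagonal (fun i => (d i : ℂ)) *
          (star (U : Matrix ι ι ℂ) * (U : Matrix ι ι ℂ)) := by simp only [mul_assoc]
      _ = _ := by rw [h, one_mul, mul_one]
  rw [diagIn, this]
  simp

theorem tr_conjDiag (d : ι → ℝ) : tr (conjDiag U d) = ∑ i, d i := by
  have := tr_mul_conjDiag U (conjDiag U d) 1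
  rw [map_one, mul_one] at this
  rw [this]
  simp [diagIn_conjDiag]

theorem diagIn_nonneg {X : Matrix ι ι ℂ} (hX : X.PosSemidef) (i : ι) : 0 ≤ diagIn U X i := by
  have h := hX.conjTranspose_mul_mul_same (U : Matrix ι ι ℂ)
  exact (Complex.le_def.1 (h.diag_nonneg (i := i))).1

/-- Commuting Hermitian matrices are simultaneously diagonalizable. -/
theorem exists_conjDiag_of_commute {A B : Matrix ι ι ℂ} (hA : A.IsHermitian)
    (hB : B.IsHermitian) (hAB : Commute A B) :
    ∃ (V : Matrix.unitaryGroup ι ℂ) (a b : ι → ℝ), A = conjDiag V a ∧ B = conjDiag V b := by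
  classical
  let E := EuclideanSpace ℂ ι
  let SA : E →ₗ[ℂ] E := A.toEuclideanLin
  let SB : E →ₗ[ℂ] E := B.toEuclideanLin
  have sA : SA.IsSymmetric := Matrix.isSymmetric_toEuclideanLin_iff.2 hA
  have sB : SB.IsSymmetric := Matrix.isSymmetric_toEuclideanLin_iff.2 hB
  have hc : Commute SA SB := by
    ext1 x
    change A.toEuclideanLin (B.toEuclideanLin x) = B.toEuclideanLin (A.toEuclideanLin x)
    rw [Matrix.toLpLin_apply, Matrix.toLpLin_apply, Matrix.toLpLin_apply, Matrix.toLpLin_apply,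
      Matrix.mulVec_mulVec, Matrix.mulVec_mulVec, hAB.eq]
  let J := Module.End.Eigenvalues SB × Module.End.Eigenvalues SA
  let W : J → Submodule ℂ E := fun j => Module.End.eigenspace SA (j.2 : ℂ) ⊓
    Module.End.eigenspace SB (j.1 : ℂ)
  have hW : OrthogonalFamily ℂ (fun j => W j) fun j => (W j).subtypeₗᵢ := by
    have := sA.orthogonalFamily_eigenspace_inf_eigenspace sB
    refine this.comp (γ := J) (f := fun j => ((j.1 : ℂ), (j.2 : ℂ))) ?_
    rintro ⟨⟨x, _⟩, ⟨y, _⟩⟩ ⟨⟨x', _⟩, ⟨y', _⟩⟩ h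
    simp only [Prod.mk.injEq] at h
    obtain ⟨rfl, rfl⟩ := h
    rfl
  have hI : DirectSum.IsInternal W := by
    rw [hW.isInternal_iff, Submodule.orthogonal_eq_bot_iff, eq_top_iff,
      ← sA.iSup_iSup_eigenspace_inf_eigenspace_eq_top_of_commute sB hc]
    refine iSup_le fun α => iSup_le fun γ => ?_
    by_cases hα : Module.End.HasEigenvalue SA α
    · by_cases hγ : Module.End.HasEigenvalue SB γ
      · exact le_iSup W (⟨γ, hγ⟩, ⟨α, hα⟩)
      · have : Module.End.eigenspace SB γ = ⊥ := by
          by_contra h; exact hγ (Module.End.hasEigenvalue_iff.2 h)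
        rw [this, inf_bot_eq]; exact bot_le
    · have : Module.End.eigenspace SA α = ⊥ := by
        by_contra h; exact hα (Module.End.hasEigenvalue_iff.2 h)
      rw [this, bot_inf_eq]; exact bot_le
  have hn : Module.finrank ℂ E = Fintype.card ι := finrank_euclideanSpace
  let b₀ := hI.subordinateOrthonormalBasis hn hW
  let e : Fin (Fintype.card ι) ≃ ι := (Fintype.equivFin ι).symm
  let b : OrthonormalBasis ι ℂ E := b₀.reindex e
  let jx : ι → J := fun i => hI.subordinateOrthonormalBasisIndex hn (e.symm i) hW
  have hb : ∀ i, b i ∈ W (jx i) := fun i => by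
    have := hI.subordinateOrthonormalBasis_subordinate hn (e.symm i) hW
    simpa [b, jx, OrthonormalBasis.reindex_apply] using this
  let M : Matrix ι ι ℂ := (EuclideanSpace.basisFun ι ℂ).toBasis.toMatrix b
  have hM : M ∈ Matrix.unitaryGroup ι ℂ :=
    (EuclideanSpace.basisFun ι ℂ).toMatrix_orthonormalBasis_mem_unitary b
  have hMa : ∀ i j, M i j = b j i := fun i j => by
    simp [M, Module.Basis.toMatrix_apply]
  have key : ∀ (C : Matrix ι ι ℂ) (c : ι → ℂ), C.IsHermitian →
      (∀ i, C.toEuclideanLin (b i) = c i • b i) →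
      ∃ d : ι → ℝ, C = conjDiag ⟨M, hM⟩ d := by
    intro C c hC h
    have hCM : C * M = M * Matrix.diagonal c := by
      ext i j
      rw [Matrix.mul_diagonal]
      have := congrArg (fun v : E => v i) (h j)
      simp only [Matrix.toLpLin_apply, Matrix.mulVec, dotProduct] at this
      rw [Matrix.mul_apply]
      simp only [hMa]
      rw [this, mul_comm]
      rfl
    have hMM : M * star M = 1 := (Matrix.mem_unitaryGroup_iff).1 hM
    have hMM' : star M * M = 1 := (Matrix.mem_unitaryGroup_iff').1 hM
    have hD : star M * C * M = Matrix.diagonal c := by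
      rw [mul_assoc, hCM, ← mul_assoc, hMM', one_mul]
    have hDh : (Matrix.diagonal c).IsHermitian := by
      rw [← hD]
      exact Matrix.isHermitian_conjTranspose_mul_mul M hC
    have hcr : ∀ i, ((c i).re : ℂ) = c i := fun i => by
      have := hDh.coe_re_apply_self i
      simpa using this
    refine ⟨fun i => (c i).re, ?_⟩
    rw [conjDiag_apply]
    simp only [hcr]
    rw [← hCM, mul_assoc, hMM, mul_one]
  obtain ⟨a, ha⟩ := key A (fun i => ((jx i).2 : ℂ)) hA fun i =>
    Module.End.mem_eigenspace_iff.1 (hb i).1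
  obtain ⟨d, hd⟩ := key B (fun i => ((jx i).1 : ℂ)) hB fun i =>
    Module.End.mem_eigenspace_iff.1 (hb i).2
  exact ⟨_, a, d, ha, hd⟩

end Diagonalization

section Pinching

variable {ι : Type*} [Fintype ι] [DecidableEq ι]

theorem specProj_conjDiag (U : Matrix.unitaryGroup ι ℂ) (d : ι → ℝ) (S : Set ℝ) :
    specProj (conjDiag U d) S = conjDiag U (fun i => S.indicator (fun _ => (1 : ℝ)) (d i)) :=
  cfc_conjDiag U _ d

theorem suppPow_conjDiag (U : Matrix.unitaryGroup ι ℂ) (d : ι → ℝ) (t : ℝ) :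
    suppPow (conjDiag U d) t = conjDiag U (fun i => if 0 < d i then d i ^ t else 0) :=
  cfc_conjDiag U _ d

theorem sum_specProj {σ : Matrix ι ι ℂ} (hσ : σ.IsHermitian) :
    ∑ x ∈ (Matrix.finite_real_spectrum (A := σ)).toFinset, specProj σ {x} = 1 := by
  obtain ⟨V, hV⟩ := exists_eq_conjDiag hσ
  have h : ∀ x, specProj σ {x} =
      conjDiag V (fun i => Set.indicator {x} (fun _ => (1 : ℝ)) (hσ.eigenvalues i)) := fun x => by
    rw [← specProj_conjDiag, ← hV]
  simp only [h]
  rw [← map_sum, ← map_one (conjDiag V)]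
  congr 1
  ext i
  rw [Finset.sum_apply, Finset.sum_eq_single (hσ.eigenvalues i)]
  · simp
  · intro b _ hb
    simp [hb.symm]
  · intro hi
    exact absurd (by simpa using hσ.eigenvalues_mem_spectrum_real i) hi

theorem isHermitian_specProj {σ : Matrix ι ι ℂ} (hσ : σ.IsHermitian) (S : Set ℝ) :
    (specProj σ S).IsHermitian := by
  obtain ⟨V, hV⟩ := exists_eq_conjDiag hσ
  rw [hV, specProj_conjDiag]
  exact isHermitian_conjDiag V _

theorem mul_specProj_singleton {σ : Matrix ι ι ℂ} (hσ : σ.IsHermitian) (x : ℝ) :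
    σ * specProj σ {x} = x • specProj σ {x} ∧ specProj σ {x} * σ = x • specProj σ {x} := by
  obtain ⟨V, hV⟩ := exists_eq_conjDiag hσ
  generalize hσ.eigenvalues = d at hV
  subst hV
  rw [specProj_conjDiag, ← map_mul, ← map_mul, ← map_smul]
  constructor <;>
  · congr 1
    ext i
    by_cases h : d i = x <;> simp [h]

theorem posSemidef_pinching {σ X : Matrix ι ι ℂ} (hσ : σ.IsHermitian) (hX : X.PosSemidef) :
    (pinching σ X).PosSemidef := by
  refine Matrix.posSemidef_sum _ fun x _ => ?_
  have := hX.mul_mul_conjTranspose_same (specProj σ {x})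
  rwa [(isHermitian_specProj hσ {x}).eq] at this

theorem commute_pinching {σ : Matrix ι ι ℂ} (hσ : σ.IsHermitian) (X : Matrix ι ι ℂ) :
    Commute σ (pinching σ X) := by
  refine Commute.sum_right _ _ _ fun x _ => ?_
  have h := mul_specProj_singleton hσ x
  change σ * _ = _ * σ
  rw [← mul_assoc, ← mul_assoc, h.1, mul_assoc _ _ σ, h.2]
  simp

theorem tr_pinching_mul_conjDiag {U : Matrix.unitaryGroup ι ℂ} (q : ι → ℝ) (X : Matrix ι ι ℂ)
    (d : ι → ℝ) : tr (pinching (conjDiag U q) X * conjDiag U d) = tr (X * conjDiag U d) := by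
  have hσ := isHermitian_conjDiag U q
  unfold tr
  congr 1
  have h1 : ∀ x : ℝ, (specProj (conjDiag U q) {x} * X * specProj (conjDiag U q) {x} *
      conjDiag U d).trace = (X * (specProj (conjDiag U q) {x} * conjDiag U d)).trace := fun x => by
    rw [specProj_conjDiag, mul_assoc, mul_assoc, Matrix.trace_mul_comm, mul_assoc, ← map_mul,
      ← map_mul]
    congr 3
    ext i
    by_cases h : q i = x <;> simp [h]
  rw [pinching, Finset.sum_mul, Matrix.trace_sum, Finset.sum_congr rfl fun x _ => h1 x,
    ← Matrix.trace_sum, ← Finset.mul_sum, ← Finset.sum_mul, sum_specProj hσ, one_mul]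

theorem exists_eq_mul_of_supp_le {ρ σ : Matrix ι ι ℂ} (h : supp ρ ≤ supp σ) :
    ∃ Z : Matrix ι ι ℂ, ρ = σ * Z := by
  have h1 : ∀ j, ∃ z : ι → ℂ, σ.mulVec z = ρ.col j := fun j => by
    have : ρ.col j ∈ supp ρ := ⟨Pi.single j 1, by simp⟩
    exact h this
  choose z hz using h1
  refine ⟨Matrix.of fun i j => z j i, ?_⟩
  ext i j
  have := congrFun (hz j) i
  simp only [Matrix.col_apply] at this
  rw [← this]
  simp [Matrix.mul_apply, Matrix.mulVec, dotProduct]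

/-- A common eigenbasis of `σ` and of the pinching of `ρ` by `σ`. -/
structure PinchedSpectrum (ρ σ : Matrix ι ι ℂ) where
  /-- The common eigenbasis. -/
  U : Matrix.unitaryGroup ι ℂ
  /-- The eigenvalues of the pinched state. -/
  p : ι → ℝ
  /-- The eigenvalues of `σ`. -/
  q : ι → ℝ
  pinching_eq : pinching σ ρ = conjDiag U p
  eq_conjDiag : σ = conjDiag U q
  diagIn_eq : ∀ i, diagIn U ρ i = p i
  p_nonneg : ∀ i, 0 ≤ p i
  q_nonneg : ∀ i, 0 ≤ q i
  sum_p : ∑ i, p i = 1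
  sum_q : ∑ i, q i = 1
  p_eq_zero : ∀ i, q i = 0 → p i = 0

theorem nonempty_pinchedSpectrum {ρ σ : Matrix ι ι ℂ} (hρ : IsState ρ) (hσ : IsState σ)
    (hsupp : supp ρ ≤ supp σ) : Nonempty (PinchedSpectrum ρ σ) := by
  obtain ⟨V, q, p, hq, hp⟩ := exists_conjDiag_of_commute hσ.1.1
    (posSemidef_pinching hσ.1.1 hρ.1).1 (commute_pinching hσ.1.1 ρ)
  have hd : ∀ i, diagIn V ρ i = p i := fun i => by
    have h1 := tr_pinching_mul_conjDiag (U := V) q ρ (Pi.single i 1)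
    rw [← hq, hp, tr_mul_conjDiag, tr_mul_conjDiag] at h1
    simpa [diagIn_conjDiag, Pi.single_apply] using h1.symm
  have hq' : ∀ i, diagIn V σ i = q i := fun i => by rw [hq, diagIn_conjDiag]
  have hsum : ∀ X : Matrix ι ι ℂ, X.trace = 1 → ∑ i, diagIn V X i = 1 := fun X hX => by
    have := tr_mul_conjDiag V X 1
    simp only [map_one, mul_one, Pi.one_apply] at this
    rw [← this, tr, hX, Complex.one_re]
  refine ⟨⟨V, p, q, hp, hq, hd, fun i => ?_, fun i => ?_, ?_, ?_, fun i hi => ?_⟩⟩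
  · rw [← hd]; exact diagIn_nonneg V hρ.1 i
  · rw [← hq']; exact diagIn_nonneg V hσ.1 i
  · simpa only [hd] using hsum ρ hρ.2
  · simpa only [hq'] using hsum σ hσ.2
  · obtain ⟨Z, hZ⟩ := exists_eq_mul_of_supp_le hsupp
    have h : star (V : Matrix ι ι ℂ) * (V : Matrix ι ι ℂ) = 1 := Unitary.coe_star_mul_self V
    have h2 : star (V : Matrix ι ι ℂ) * ρ * (V : Matrix ι ι ℂ) =
        Matrix.diagonal (fun i => (q i : ℂ)) * (star (V : Matrix ι ι ℂ) * Z * V) := by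
      rw [hZ, hq, conjDiag_apply]
      calc _ = (star (V : Matrix ι ι ℂ) * (V : Matrix ι ι ℂ)) *
          Matrix.diagonal (fun i => (q i : ℂ)) * (star (V : Matrix ι ι ℂ) * Z * V) := by
            simp only [mul_assoc]
        _ = _ := by rw [h, one_mul]
    rw [← hd, diagIn, h2, Matrix.diagonal_mul, hi]
    simp

namespace PinchedSpectrum

variable {ρ σ : Matrix ι ι ℂ} (S : PinchedSpectrum ρ σ)

/-- The log-likelihood ratio `log (p / q)`. -/
def llr (i : ι) : ℝ := Real.log (S.p i / S.q i)

/-- The moment generating function of the log-likelihood ratio under `p`. -/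
def mgf (t : ℝ) : ℝ := ∑ i, S.p i * Real.exp (t * S.llr i)

theorem q_pos {i : ι} (hi : 0 < S.p i) : 0 < S.q i :=
  (S.q_nonneg i).lt_of_ne fun h => hi.ne' (S.p_eq_zero i h.symm)

theorem p_eq_q_mul_exp {i : ι} (hi : 0 < S.p i) : S.p i = S.q i * Real.exp (S.llr i) := by
  have := S.q_pos hi
  rw [llr, Real.exp_log (div_pos hi this)]
  field_simp

theorem tr_mul_conjDiag_left (d : ι → ℝ) : tr (ρ * conjDiag S.U d) = ∑ i, S.p i * d i := by
  rw [tr_mul_conjDiag]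
  simp only [S.diagIn_eq]

theorem tr_mul_conjDiag_right (d : ι → ℝ) : tr (σ * conjDiag S.U d) = ∑ i, S.q i * d i := by
  rw [tr_mul_conjDiag]
  refine Finset.sum_congr rfl fun i _ => ?_
  congr 1
  exact (congrArg (fun X => diagIn S.U X i) S.eq_conjDiag).trans (diagIn_conjDiag _ _ _)

theorem Q_eq_mgf (t : ℝ) : Q (1 + t) (pinching σ ρ) σ = S.mgf t := by
  have h : suppPow σ (1 - (1 + t)) =
      conjDiag S.U (fun i => if 0 < S.q i then S.q i ^ (1 - (1 + t)) else 0) := by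
    conv_lhs => rw [S.eq_conjDiag]
    exact suppPow_conjDiag _ _ _
  rw [Q, S.pinching_eq, suppPow_conjDiag, h, ← map_mul, tr_conjDiag, mgf]
  refine Finset.sum_congr rfl fun i _ => ?_
  rw [Pi.mul_apply]
  rcases (S.p_nonneg i).eq_or_lt' with hp | hp
  · simp [hp]
  · have hq := S.q_pos hp
    rw [if_pos hp, if_pos hq, llr, mul_comm t, Real.exp_mul, Real.exp_log (div_pos hp hq),
      Real.div_rpow hp.le hq.le, Real.rpow_add hp, Real.rpow_one,
      show 1 - (1 + t) = -t by ring, Real.rpow_neg hq.le]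
    field_simp

open scoped Classical in
/-- The test that accepts the common eigenvectors with eigenvalues `p i > 0` and log-likelihood
ratio in `W`, with probability `c`. -/
def windowTest (W : Set ℝ) (c : ℝ) : Matrix ι ι ℂ :=
  conjDiag S.U fun i => if 0 < S.p i ∧ S.llr i ∈ W then c else 0

open scoped Classical in
/-- The weight, with respect to `m`, of the log-likelihood ratios in `W`. -/
def mass (m : ι → ℝ) (W : Set ℝ) : ℝ := ∑ i, if 0 < S.p i ∧ S.llr i ∈ W then m i else 0

theorem isTest_windowTest (W : Set ℝ) {c : ℝ} (h0 : 0 ≤ c) (h1 : c ≤ 1) :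
    IsTest (S.windowTest W c) := by
  classical
  constructor
  · refine posSemidef_conjDiag _ fun i => ?_
    split_ifs
    exacts [h0, le_rfl]
  · rw [windowTest, ← map_one (conjDiag S.U), ← map_sub]
    refine posSemidef_conjDiag _ fun i => ?_
    simp only [Pi.sub_apply, Pi.one_apply]
    split_ifs <;> linarith

theorem tr_left_windowTest (W : Set ℝ) (c : ℝ) :
    tr (ρ * S.windowTest W c) = c * S.mass S.p W := by
  rw [windowTest, tr_mul_conjDiag_left, mass, Finset.mul_sum]
  refine Finset.sum_congr rfl fun i _ => ?_
  split_ifs <;> ring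

theorem tr_right_windowTest (W : Set ℝ) (c : ℝ) :
    tr (σ * S.windowTest W c) = c * S.mass S.q W := by
  rw [windowTest, tr_mul_conjDiag_right, mass, Finset.mul_sum]
  refine Finset.sum_congr rfl fun i _ => ?_
  split_ifs <;> ring

/-- The pinched Neyman-Pearson test accepts the log-likelihood ratios above the threshold. -/
theorem specProj_eq_windowTest (c : ℝ) :
    specProj (pinching σ ρ - Real.exp c • σ) (Set.Ioi 0) = S.windowTest (Set.Ioi c) 1 := by
  have h : pinching σ ρ - Real.exp c • σ = conjDiag S.U (S.p - Real.exp c • S.q) := by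
    rw [map_sub, map_smul, ← S.pinching_eq, ← S.eq_conjDiag]
  rw [h, specProj_conjDiag, windowTest]
  congr 1
  ext i
  simp only [Set.indicator_apply, Set.mem_Ioi, Pi.sub_apply, Pi.smul_apply, smul_eq_mul, sub_pos]
  refine if_congr ?_ rfl rfl
  rcases (S.p_nonneg i).eq_or_lt' with hp | hp
  · simp [hp, mul_nonneg (Real.exp_pos c).le (S.q_nonneg i)]
  · have hq := S.q_pos hp
    rw [llr, Real.lt_log_iff_exp_lt (div_pos hp hq), lt_div_iff₀ hq]
    simp [hp]

end PinchedSpectrum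

end Pinching

section TraceInequalities

variable {ι : Type*} [Fintype ι] [DecidableEq ι]

theorem tr_cfc_eq_sum {A : Matrix ι ι ℂ} (hA : A.IsHermitian) (f : ℝ → ℝ) :
    tr (cfc f A) = ∑ i, f (hA.eigenvalues i) := by
  obtain ⟨V, hV⟩ := exists_eq_conjDiag hA
  conv_lhs => rw [hV]
  rw [cfc_conjDiag, tr_conjDiag]

/-- `X * Xᴴ` and `Xᴴ * X` have the same eigenvalues. -/
theorem tr_cfc_mul_conjTranspose (X : Matrix ι ι ℂ) (f : ℝ → ℝ) :
    tr (cfc f (X * X.conjTranspose)) = tr (cfc f (X.conjTranspose * X)) := by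
  have h1 : (X * X.conjTranspose).IsHermitian := Matrix.isHermitian_mul_conjTranspose_self X
  have h2 : (X.conjTranspose * X).IsHermitian := Matrix.isHermitian_conjTranspose_mul_self X
  have h := h1.roots_charpoly_eq_eigenvalues
  rw [Matrix.charpoly_mul_comm, h2.roots_charpoly_eq_eigenvalues] at h
  rw [tr_cfc_eq_sum h1, tr_cfc_eq_sum h2]
  have h3 := congrArg (fun m => (m.map fun z : ℂ => f z.re).sum) h
  simpa using h3.symm

theorem diagIn_mul_conjDiag_mul (U V : Matrix.unitaryGroup ι ℂ) (K : Matrix ι ι ℂ) (a : ι → ℝ)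
    (i : ι) : diagIn U (K * conjDiag V a * K.conjTranspose) i =
      ∑ j, Complex.normSq ((star (U : Matrix ι ι ℂ) * K * (V : Matrix ι ι ℂ)) i j) * a j := by
  set G := star (U : Matrix ι ι ℂ) * K * (V : Matrix ι ι ℂ) with hG
  have h : star (U : Matrix ι ι ℂ) * (K * conjDiag V a * K.conjTranspose) * (U : Matrix ι ι ℂ) =
      G * Matrix.diagonal (fun i => (a i : ℂ)) * G.conjTranspose := by
    rw [hG, conjDiag_apply]
    simp only [Matrix.star_eq_conjTranspose, Matrix.conjTranspose_mul,
      Matrix.conjTranspose_conjTranspose, mul_assoc]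
  rw [diagIn, h, Matrix.mul_apply, Complex.re_sum]
  refine Finset.sum_congr rfl fun j _ => ?_
  rw [Matrix.mul_diagonal, Matrix.conjTranspose_apply, mul_right_comm, Complex.star_def,
    Complex.mul_conj, ← Complex.ofReal_mul, Complex.ofReal_re]

theorem diagIn_one (U : Matrix.unitaryGroup ι ℂ) (i : ι) : diagIn U 1 i = 1 := by
  rw [← map_one (conjDiag U), diagIn_conjDiag]; rfl

theorem sum_diagIn (U : Matrix.unitaryGroup ι ℂ) (X : Matrix ι ι ℂ) :
    ∑ i, diagIn U X i = tr X := by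
  have := tr_mul_conjDiag U X 1
  simpa using this.symm

theorem suppPow_conjDiag_of_pos (U : Matrix.unitaryGroup ι ℂ) {d : ι → ℝ} (hd : ∀ i, 0 ≤ d i)
    {t : ℝ} (ht : 0 < t) : suppPow (conjDiag U d) t = conjDiag U fun i => d i ^ t := by
  rw [suppPow_conjDiag]
  congr 1
  ext i
  rcases (hd i).eq_or_lt' with h | h
  · simp [h, ht.ne']
  · simp [h]

theorem suppPow_mul_suppPow {A : Matrix ι ι ℂ} (hA : A.PosSemidef) (s t : ℝ) :
    suppPow A s * suppPow A t = suppPow A (s + t) := by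
  obtain ⟨V, d, hd, rfl⟩ := exists_eq_conjDiag_of_posSemidef hA
  simp only [suppPow_conjDiag, ← map_mul]
  congr 1
  ext i
  by_cases h : 0 < d i
  · simp [h, Real.rpow_add h]
  · simp [h]

theorem suppPow_one {A : Matrix ι ι ℂ} (hA : A.PosSemidef) : suppPow A 1 = A := by
  obtain ⟨V, d, hd, rfl⟩ := exists_eq_conjDiag_of_posSemidef hA
  rw [suppPow_conjDiag_of_pos V hd one_pos]
  simp

theorem suppPow_suppPow {A : Matrix ι ι ℂ} (hA : A.PosSemidef) {s t : ℝ} (hs : 0 < s)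
    (ht : 0 < t) : suppPow (suppPow A s) t = suppPow A (s * t) := by
  obtain ⟨V, d, hd, rfl⟩ := exists_eq_conjDiag_of_posSemidef hA
  rw [suppPow_conjDiag_of_pos V hd hs, suppPow_conjDiag_of_pos V hd (mul_pos hs ht),
    suppPow_conjDiag_of_pos V (fun i => Real.rpow_nonneg (hd i) s) ht]
  congr 1
  ext i
  rw [Real.rpow_mul (hd i)]

theorem posSemidef_suppPow {A : Matrix ι ι ℂ} (hA : A.PosSemidef) (t : ℝ) :
    (suppPow A t).PosSemidef := by
  obtain ⟨V, d, hd, rfl⟩ := exists_eq_conjDiag_of_posSemidef hA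
  rw [suppPow_conjDiag]
  refine posSemidef_conjDiag V fun i => ?_
  split_ifs with h
  exacts [Real.rpow_nonneg h.le t, le_rfl]

omit [DecidableEq ι] in
theorem tr_nonneg {A : Matrix ι ι ℂ} (hA : A.PosSemidef) : 0 ≤ tr A :=
  (Complex.le_def.1 hA.trace_nonneg).1

theorem tr_mul_nonneg {A B : Matrix ι ι ℂ} (hA : A.PosSemidef) (hB : B.PosSemidef) :
    0 ≤ tr (A * B) := by
  obtain ⟨V, d, hd, rfl⟩ := exists_eq_conjDiag_of_posSemidef hB
  rw [tr_mul_conjDiag]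
  exact Finset.sum_nonneg fun i _ => mul_nonneg (diagIn_nonneg V hA i) (hd i)

omit [DecidableEq ι] in
theorem tr_mul_comm (A B : Matrix ι ι ℂ) : tr (A * B) = tr (B * A) := by
  rw [tr, tr, Matrix.trace_mul_comm]

/-- Hölder's inequality for the trace. -/
theorem tr_mul_le_tr_suppPow {M N : Matrix ι ι ℂ} (hM : M.PosSemidef) (hN : N.PosSemidef)
    {p q : ℝ} (hpq : p.HolderConjugate q) :
    tr (M * N) ≤ tr (suppPow M p) ^ (1 / p) * tr (suppPow N q) ^ (1 / q) := by
  obtain ⟨U, m, hm, rfl⟩ := exists_eq_conjDiag_of_posSemidef hM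
  obtain ⟨V, n, hn, rfl⟩ := exists_eq_conjDiag_of_posSemidef hN
  let w : ι → ι → ℝ := fun j i =>
    Complex.normSq ((star (V : Matrix ι ι ℂ) * (U : Matrix ι ι ℂ)) j i)
  have hw0 : ∀ j i, 0 ≤ w j i := fun j i => Complex.normSq_nonneg _
  have hrow : ∀ a j, diagIn V (conjDiag U a) j = ∑ i, w j i * a i := fun a j => by
    simpa [w] using diagIn_mul_conjDiag_mul V U 1 a j
  have hcol : ∀ a i, diagIn U (conjDiag V a) i = ∑ j, w j i * a j := fun a i => by
    have := diagIn_mul_conjDiag_mul U V 1 a i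
    simp only [one_mul, Matrix.conjTranspose_one, mul_one] at this
    rw [this]
    refine Finset.sum_congr rfl fun j _ => ?_
    have h : star (V : Matrix ι ι ℂ) * (U : Matrix ι ι ℂ) =
        star (star (U : Matrix ι ι ℂ) * (V : Matrix ι ι ℂ)) := by simp
    simp only [w]
    rw [h, Matrix.star_apply, Complex.star_def, Complex.normSq_conj]
  have hsum1 : ∑ x : ι × ι, w x.1 x.2 * m x.2 ^ p = tr (suppPow (conjDiag U m) p) := by
    rw [suppPow_conjDiag_of_pos U hm hpq.pos, ← sum_diagIn V, Fintype.sum_prod_type]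
    exact Finset.sum_congr rfl fun j _ => (hrow _ j).symm
  have hsum2 : ∑ x : ι × ι, w x.1 x.2 * n x.1 ^ q = tr (suppPow (conjDiag V n) q) := by
    rw [suppPow_conjDiag_of_pos V hn hpq.symm.pos, ← sum_diagIn U, Fintype.sum_prod_type_right]
    exact Finset.sum_congr rfl fun i _ => (hcol _ i).symm
  have key := Real.inner_le_Lp_mul_Lq_of_nonneg (Finset.univ : Finset (ι × ι))
    (f := fun x => w x.1 x.2 ^ (1 / p) * m x.2) (g := fun x => w x.1 x.2 ^ (1 / q) * n x.1) hpq
    (fun x _ => mul_nonneg (Real.rpow_nonneg (hw0 _ _) _) (hm _))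
    (fun x _ => mul_nonneg (Real.rpow_nonneg (hw0 _ _) _) (hn _))
  have h1 : ∀ x : ι × ι, (w x.1 x.2 ^ (1 / p) * m x.2) ^ p = w x.1 x.2 * m x.2 ^ p := fun x => by
    rw [Real.mul_rpow (Real.rpow_nonneg (hw0 _ _) _) (hm _), ← Real.rpow_mul (hw0 _ _),
      one_div_mul_cancel hpq.ne_zero, Real.rpow_one]
  have h2 : ∀ x : ι × ι, (w x.1 x.2 ^ (1 / q) * n x.1) ^ q = w x.1 x.2 * n x.1 ^ q := fun x => by
    rw [Real.mul_rpow (Real.rpow_nonneg (hw0 _ _) _) (hn _), ← Real.rpow_mul (hw0 _ _),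
      one_div_mul_cancel hpq.symm.ne_zero, Real.rpow_one]
  have h3 : ∀ x : ι × ι, w x.1 x.2 ^ (1 / p) * m x.2 * (w x.1 x.2 ^ (1 / q) * n x.1) =
      w x.1 x.2 * m x.2 * n x.1 := fun x => by
    have : w x.1 x.2 ^ (1 / p) * w x.1 x.2 ^ (1 / q) = w x.1 x.2 := by
      have h : 1 / p + 1 / q = 1 := by simpa using hpq.inv_add_inv_eq_one
      rw [← Real.rpow_add' (hw0 _ _) (by rw [h]; exact one_ne_zero), h, Real.rpow_one]
    linear_combination (m x.2 * n x.1) * this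
  simp only [h1, h2, h3, hsum1, hsum2] at key
  refine le_trans (le_of_eq ?_) key
  rw [tr_mul_conjDiag, Fintype.sum_prod_type]
  refine Finset.sum_congr rfl fun j _ => ?_
  rw [hrow, Finset.sum_mul]

/-- The trace Jensen inequality for a power of a compression by a contraction. -/
theorem tr_suppPow_compression_le {A K : Matrix ι ι ℂ} (hA : A.PosSemidef) (hK : K.IsHermitian)
    (hK1 : (1 - K * K).PosSemidef) {q : ℝ} (hq : 1 < q) :
    tr (suppPow (K * A * K) q) ≤ tr (K * suppPow A q * K) := by
  have hB : (K * A * K).PosSemidef := by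
    simpa [hK.eq] using hA.mul_mul_conjTranspose_same K
  obtain ⟨W, b, hb, hBW⟩ := exists_eq_conjDiag_of_posSemidef hB
  obtain ⟨V, a, ha, rfl⟩ := exists_eq_conjDiag_of_posSemidef hA
  rw [suppPow_conjDiag_of_pos V ha (by linarith), ← sum_diagIn W (K * _ * K), hBW,
    suppPow_conjDiag_of_pos W hb (by linarith), tr_conjDiag]
  refine Finset.sum_le_sum fun i _ => ?_
  let w : ι → ℝ := fun j =>
    Complex.normSq ((star (W : Matrix ι ι ℂ) * K * (V : Matrix ι ι ℂ)) i j)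
  have hw0 : ∀ j, 0 ≤ w j := fun j => Complex.normSq_nonneg _
  have hw : ∀ c, diagIn W (K * conjDiag V c * K) i = ∑ j, w j * c j := fun c => by
    have := diagIn_mul_conjDiag_mul W V K c i
    rwa [hK.eq] at this
  have hw1 : ∑ j, w j ≤ 1 := by
    have h1 := hw 1
    have h2 := diagIn_nonneg W hK1 i
    have h3 : diagIn W (1 - K * K) i = diagIn W 1 i - diagIn W (K * K) i := by
      simp only [diagIn, mul_sub, sub_mul, Matrix.sub_apply, Complex.sub_re]
    simp only [map_one, mul_one, Pi.one_apply] at h1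
    rw [h3, diagIn_one, h1] at h2
    linarith
  have hbi : b i = ∑ j, w j * a j := by rw [← hw, hBW, diagIn_conjDiag]
  have hs : 0 ≤ ∑ j, w j * a j ^ q :=
    Finset.sum_nonneg fun j _ => mul_nonneg (hw0 j) (Real.rpow_nonneg (ha j) q)
  have hb' : b i ≤ (∑ j, w j * a j ^ q) ^ q⁻¹ := by
    rw [hbi]
    refine (Real.inner_le_weight_mul_Lp_of_nonneg _ hq.le w a hw0 ha).trans ?_
    refine mul_le_of_le_one_left (Real.rpow_nonneg hs _) ?_
    refine Real.rpow_le_one (Finset.sum_nonneg fun j _ => hw0 j) hw1 ?_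
    rw [sub_nonneg]
    exact inv_le_one_of_one_le₀ hq.le
  rw [hw]
  calc b i ^ q ≤ ((∑ j, w j * a j ^ q) ^ q⁻¹) ^ q :=
        Real.rpow_le_rpow (hb i) hb' (by linarith)
    _ = _ := Real.rpow_inv_rpow hs (by linarith)

/-- Monotonicity of the sandwiched Rényi quantity under the binary measurement `{T, 1 - T}`. -/
theorem tr_mul_test_le {ρ σ T : Matrix ι ι ℂ} (hρ : ρ.PosSemidef) (hσ : σ.PosSemidef)
    (hsupp : supp ρ ≤ supp σ) (hT : IsTest T) {α : ℝ} (hα : 1 < α) :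
    tr (ρ * T) ≤ Qstar α ρ σ ^ (1 / α) * tr (σ * T) ^ ((α - 1) / α) := by
  have hα0 : 0 < α := by linarith
  set s := (α - 1) / α with hs
  have hs0 : 0 < s := div_pos (by linarith) hα0
  set q := α / (α - 1) with hq
  have hpq : α.HolderConjugate q := Real.HolderConjugate.conjExponent hα
  have hsq : s * q = 1 := by
    rw [hs, hq]; field_simp [show α - 1 ≠ 0 by linarith]
  have hq1 : 1 / q = s := by rw [hs, hq, one_div_div]
  set B := suppPow σ (-s / 2) with hB
  set C := suppPow ρ (1 / 2) with hC
  set D := suppPow σ (s / 2) with hD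
  set K := suppPow T (1 / 2) with hK
  have hBh : B.conjTranspose = B := (posSemidef_suppPow hσ _).1
  have hCh : C.conjTranspose = C := (posSemidef_suppPow hρ _).1
  have hDh : D.conjTranspose = D := (posSemidef_suppPow hσ _).1
  have hKh : K.conjTranspose = K := (posSemidef_suppPow hT.1 _).1
  have hCC : C * C = ρ := by
    rw [hC, suppPow_mul_suppPow hρ, add_halves, suppPow_one hρ]
  have hKK : K * K = T := by
    rw [hK, suppPow_mul_suppPow hT.1, add_halves, suppPow_one hT.1]
  have hBB : B * B = suppPow σ ((1 - α) / α) := by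
    rw [hB, suppPow_mul_suppPow hσ, add_halves, hs, ← neg_div, neg_sub]
  have hDD : D * D = suppPow σ s := by
    rw [hD, suppPow_mul_suppPow hσ, add_halves]
  have hDBρ : D * B * ρ = ρ := by
    obtain ⟨Z, hZ⟩ := exists_eq_mul_of_supp_le hsupp
    have : D * B * σ = σ := by
      calc D * B * σ = D * B * suppPow σ 1 := by rw [suppPow_one hσ]
        _ = suppPow σ 1 := by
          rw [hD, hB, suppPow_mul_suppPow hσ, suppPow_mul_suppPow hσ]
          congr 1
          ring
        _ = σ := suppPow_one hσ
    rw [hZ, ← mul_assoc, this]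
  have hρBD : ρ * B * D = ρ := by
    have := congrArg Matrix.conjTranspose hDBρ
    simpa only [Matrix.conjTranspose_mul, hDh, hBh, hρ.1.eq, ← mul_assoc] using this
  have hQ : Qstar α ρ σ = tr (suppPow (B * ρ * B) α) := by
    have h1 := tr_cfc_mul_conjTranspose (B * C) (fun x : ℝ => if 0 < x then x ^ α else 0)
    rw [Matrix.conjTranspose_mul, hBh, hCh] at h1
    have h2 : B * C * (C * B) = B * ρ * B := by rw [← hCC]; simp only [mul_assoc]
    have h3 : C * B * (B * C) = C * suppPow σ ((1 - α) / α) * C := by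
      rw [← hBB]; simp only [mul_assoc]
    rw [h2, h3] at h1
    exact h1.symm
  have hN : tr (suppPow (D * T * D) q) ≤ tr (σ * T) := by
    have h1 := tr_cfc_mul_conjTranspose (D * K) (fun x : ℝ => if 0 < x then x ^ q else 0)
    rw [Matrix.conjTranspose_mul, hDh, hKh] at h1
    have h2 : D * K * (K * D) = D * T * D := by rw [← hKK]; simp only [mul_assoc]
    have h3 : K * D * (D * K) = K * suppPow σ s * K := by rw [← hDD]; simp only [mul_assoc]
    rw [h2, h3] at h1
    refine (le_of_eq h1).trans ?_
    refine (tr_suppPow_compression_le (posSemidef_suppPow hσ s) hKh ?_ hpq.symm.lt).trans ?_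
    · rw [hKK]; exact hT.2
    · rw [suppPow_suppPow hσ hs0 hpq.symm.pos, hsq, suppPow_one hσ, tr_mul_comm, ← mul_assoc,
        hKK, tr_mul_comm]
  have hM0 : (B * ρ * B).PosSemidef := by simpa [hBh] using hρ.mul_mul_conjTranspose_same B
  have hN0 : (D * T * D).PosSemidef := by simpa [hDh] using hT.1.mul_mul_conjTranspose_same D
  have h1 : tr (ρ * T) = tr ((B * ρ * B) * (D * T * D)) := by
    calc tr (ρ * T) = tr (D * B * (ρ * B * D) * T) := by rw [hρBD, hDBρ]
      _ = tr (D * (B * ρ * B * D * T)) := by simp only [mul_assoc]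
      _ = tr (B * ρ * B * D * T * D) := tr_mul_comm _ _
      _ = _ := by simp only [mul_assoc]
  rw [h1, hQ, ← hq1]
  refine (tr_mul_le_tr_suppPow hM0 hN0 hpq).trans ?_
  refine mul_le_mul_of_nonneg_left ?_ (Real.rpow_nonneg (tr_nonneg (posSemidef_suppPow hM0 _)) _)
  exact Real.rpow_le_rpow (tr_nonneg (posSemidef_suppPow hN0 _)) hN (by rw [hq1]; exact hs0.le)

theorem Qstar_nonneg {ρ σ : Matrix ι ι ℂ} (hρ : ρ.PosSemidef) (hσ : σ.PosSemidef) (α : ℝ) :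
    0 ≤ Qstar α ρ σ := by
  refine tr_nonneg (posSemidef_suppPow ?_ _)
  have := (posSemidef_suppPow hσ ((1 - α) / α)).mul_mul_conjTranspose_same (suppPow ρ (1 / 2))
  rwa [(posSemidef_suppPow hρ (1 / 2)).1.eq] at this

end TraceInequalities

namespace PinchedSpectrum

section Mass

variable {ι : Type*} [Fintype ι] [DecidableEq ι] {ρ σ : Matrix ι ι ℂ} (S : PinchedSpectrum ρ σ)

theorem mgf_zero : S.mgf 0 = 1 := by
  simp [mgf, S.sum_p]

theorem one_le_mgf {t : ℝ} (ht : 0 ≤ t) : 1 ≤ S.mgf t := by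
  have h : ∀ i, S.p i - t * S.q i + t * S.p i ≤ S.p i * Real.exp (t * S.llr i) := fun i => by
    rcases (S.p_nonneg i).eq_or_lt' with hp | hp
    · have := mul_nonneg ht (S.q_nonneg i)
      simp only [hp]; linarith
    · have h1 := Real.add_one_le_exp (t * S.llr i)
      have h2 := Real.add_one_le_exp (-S.llr i)
      have h3 : S.q i = S.p i * Real.exp (-S.llr i) := by
        conv_rhs => rw [S.p_eq_q_mul_exp hp]
        rw [mul_assoc, ← Real.exp_add, add_neg_cancel, Real.exp_zero, mul_one]
      have h4 := mul_le_mul_of_nonneg_left h1 hp.le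
      have h5 := mul_le_mul_of_nonneg_left h2 (mul_nonneg ht hp.le)
      rw [h3]
      linarith
  calc (1 : ℝ) = ∑ i, (S.p i - t * S.q i + t * S.p i) := by
        rw [Finset.sum_add_distrib, Finset.sum_sub_distrib, ← Finset.mul_sum, ← Finset.mul_sum,
          S.sum_p, S.sum_q]
        ring
    _ ≤ _ := Finset.sum_le_sum fun i _ => h i

theorem mgf_pos (t : ℝ) : 0 < S.mgf t := by
  obtain ⟨i, -, hi⟩ := Finset.exists_ne_zero_of_sum_ne_zero (by rw [S.sum_p]; exact one_ne_zero)
  exact Finset.sum_pos' (fun j _ => mul_nonneg (S.p_nonneg j) (Real.exp_pos _).le)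
    ⟨i, Finset.mem_univ i, mul_pos ((S.p_nonneg i).lt_of_ne' hi) (Real.exp_pos _)⟩

theorem convexOn_log_mgf : ConvexOn ℝ Set.univ fun t => Real.log (S.mgf t) := by
  refine ⟨convex_univ, fun a _ b _ x y hx hy hxy => ?_⟩
  simp only [smul_eq_mul]
  set A := Real.log (S.mgf a) with hA
  set B := Real.log (S.mgf b) with hB
  rw [← Real.log_exp (x * A + y * B)]
  refine Real.log_le_log (S.mgf_pos _) ?_
  have h : ∀ i, S.p i * Real.exp ((x * a + y * b) * S.llr i) ≤
      Real.exp (x * A + y * B) * (x * (Real.exp (-A) * (S.p i * Real.exp (a * S.llr i))) +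
        y * (Real.exp (-B) * (S.p i * Real.exp (b * S.llr i)))) := fun i => by
    have h1 := convexOn_exp.2 (Set.mem_univ (a * S.llr i - A)) (Set.mem_univ (b * S.llr i - B))
      hx hy hxy
    simp only [smul_eq_mul] at h1
    have h2 : Real.exp ((x * a + y * b) * S.llr i) = Real.exp (x * A + y * B) *
        Real.exp (x * (a * S.llr i - A) + y * (b * S.llr i - B)) := by
      rw [← Real.exp_add]; congr 1; ring
    have h3 : ∀ c C, Real.exp (c * S.llr i - C) = Real.exp (-C) * Real.exp (c * S.llr i) :=
      fun c C => by rw [← Real.exp_add]; congr 1; ring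
    rw [h3, h3] at h1
    rw [h2]
    have h4 := mul_le_mul_of_nonneg_left h1
      (mul_nonneg (S.p_nonneg i) (Real.exp_pos (x * A + y * B)).le)
    linarith
  refine (Finset.sum_le_sum fun i _ => h i).trans (le_of_eq ?_)
  have hm : ∀ c, Real.exp (-Real.log (S.mgf c)) * S.mgf c = 1 := fun c => by
    rw [Real.exp_neg, Real.exp_log (S.mgf_pos c), inv_mul_cancel₀ (S.mgf_pos c).ne']
  have hma := hm a
  have hmb := hm b
  rw [mgf] at hma hmb
  rw [← Finset.mul_sum, Finset.sum_add_distrib, ← Finset.mul_sum, ← Finset.mul_sum,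
    ← Finset.mul_sum, ← Finset.mul_sum]
  simp only [hA, hB]
  rw [mgf, mgf, hma, hmb, mul_one, mul_one, hxy, mul_one]

theorem mass_mono {m : ι → ℝ} (hm : ∀ i, 0 ≤ m i) {W W' : Set ℝ} (h : W ⊆ W') :
    S.mass m W ≤ S.mass m W' := by
  classical
  refine Finset.sum_le_sum fun i _ => ?_
  by_cases h1 : 0 < S.p i ∧ S.llr i ∈ W
  · rw [if_pos h1, if_pos ⟨h1.1, h h1.2⟩]
  · rw [if_neg h1]
    split_ifs
    exacts [hm i, le_rfl]

/-- The exponential Chebyshev inequality. -/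
theorem mass_p_Ioi_le {t : ℝ} (ht : 0 ≤ t) (x : ℝ) :
    S.mass S.p (Set.Ioi x) ≤ Real.exp (-(t * x)) * S.mgf t := by
  classical
  rw [mgf, Finset.mul_sum]
  refine Finset.sum_le_sum fun i _ => ?_
  have h0 := S.p_nonneg i
  split_ifs with h
  · have h1 : 1 ≤ Real.exp (-(t * x)) * Real.exp (t * S.llr i) := by
      rw [← Real.exp_add]
      refine Real.one_le_exp ?_
      have := mul_le_mul_of_nonneg_left (le_of_lt h.2) ht
      linarith
    linarith [mul_le_mul_of_nonneg_left h1 h0]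
  · positivity

theorem mass_q_Ioi_le (x : ℝ) :
    S.mass S.q (Set.Ioi x) ≤ Real.exp (-x) * S.mass S.p (Set.Ioi x) := by
  classical
  rw [mass, mass, Finset.mul_sum]
  refine Finset.sum_le_sum fun i _ => ?_
  split_ifs with h
  · conv_rhs => rw [S.p_eq_q_mul_exp h.1]
    have h1 : 1 ≤ Real.exp (-x) * Real.exp (S.llr i) := by
      rw [← Real.exp_add]
      refine Real.one_le_exp ?_
      have : x < S.llr i := h.2
      linarith
    linarith [mul_le_mul_of_nonneg_left h1 (S.q_nonneg i)]
  · simp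

theorem le_mass_q_Ioo (x y : ℝ) :
    Real.exp (-y) * S.mass S.p (Set.Ioo x y) ≤ S.mass S.q (Set.Ioo x y) := by
  classical
  rw [mass, mass, Finset.mul_sum]
  refine Finset.sum_le_sum fun i _ => ?_
  split_ifs with h
  · conv_lhs => rw [S.p_eq_q_mul_exp h.1]
    have h1 : Real.exp (-y) * Real.exp (S.llr i) ≤ 1 := by
      rw [← Real.exp_add]
      refine Real.exp_le_one_iff.2 ?_
      have : S.llr i < y := h.2.2
      linarith
    linarith [mul_le_mul_of_nonneg_left h1 (S.q_nonneg i)]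
  · simp

/-- The part of the moment generating function outside a window is controlled by its values at
neighbouring points. -/
theorem le_mass_p_Ioo {s t : ℝ} (hs : 0 ≤ s) (ht : 0 ≤ t) (x y : ℝ) :
    Real.exp (-(t * y)) * (S.mgf t - Real.exp (-(s * y)) * S.mgf (t + s) -
      Real.exp (s * x) * S.mgf (t - s)) ≤ S.mass S.p (Set.Ioo x y) := by
  classical
  rw [mgf, mgf, mgf, mass, Finset.mul_sum, Finset.mul_sum, ← Finset.sum_sub_distrib,
    ← Finset.sum_sub_distrib, Finset.mul_sum]
  refine Finset.sum_le_sum fun i _ => ?_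
  set l := S.llr i
  rcases (S.p_nonneg i).eq_or_lt' with h0 | h0
  · simp [h0]
  have e1 : Real.exp (-(s * y)) * (S.p i * Real.exp ((t + s) * l)) =
      S.p i * Real.exp (t * l) * Real.exp (s * (l - y)) := by
    rw [mul_left_comm, mul_assoc, ← Real.exp_add, ← Real.exp_add]; congr 2; ring
  have e2 : Real.exp (s * x) * (S.p i * Real.exp ((t - s) * l)) =
      S.p i * Real.exp (t * l) * Real.exp (s * (x - l)) := by
    rw [mul_left_comm, mul_assoc, ← Real.exp_add, ← Real.exp_add]; congr 2; ring
  rw [e1, e2]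
  have hE : 0 < S.p i * Real.exp (t * l) := mul_pos h0 (Real.exp_pos _)
  have p1 := mul_pos hE (Real.exp_pos (s * (l - y)))
  have p2 := mul_pos hE (Real.exp_pos (s * (x - l)))
  have hE' := Real.exp_pos (-(t * y))
  by_cases hl : l ∈ Set.Ioo x y
  · rw [if_pos ⟨h0, hl⟩]
    have h1 : Real.exp (-(t * y)) * Real.exp (t * l) ≤ 1 := by
      rw [← Real.exp_add]
      refine Real.exp_le_one_iff.2 ?_
      have := mul_le_mul_of_nonneg_left hl.2.le ht
      linarith
    calc _ ≤ Real.exp (-(t * y)) * (S.p i * Real.exp (t * l)) :=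
          mul_le_mul_of_nonneg_left (by linarith) hE'.le
      _ = S.p i * (Real.exp (-(t * y)) * Real.exp (t * l)) := by ring
      _ ≤ S.p i := mul_le_of_le_one_right h0.le h1
  · rw [if_neg fun h => hl h.2]
    refine mul_nonpos_of_nonneg_of_nonpos hE'.le ?_
    rcases le_or_gt l x with h | h
    · have : 1 ≤ Real.exp (s * (x - l)) :=
        Real.one_le_exp (mul_nonneg hs (sub_nonneg.2 h))
      linarith [mul_le_mul_of_nonneg_left this hE.le]
    · have hy : y ≤ l := by
        by_contra h'
        exact hl ⟨h, not_le.1 h'⟩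
      have : 1 ≤ Real.exp (s * (l - y)) :=
        Real.one_le_exp (mul_nonneg hs (sub_nonneg.2 hy))
      linarith [mul_le_mul_of_nonneg_left this hE.le]

end Mass

end PinchedSpectrum

section Sequences

variable {ι : ℕ → Type*} [∀ n, Fintype (ι n)] [∀ n, DecidableEq (ι n)]
  {ρ σ : ∀ n, Matrix (ι n) (ι n) ℂ}

/-- `F` is the limiting cumulant generating function of the log-likelihood ratios. -/
def IsCGF (S : ∀ n, PinchedSpectrum (ρ n) (σ n)) (F : ℝ → ℝ) : Prop :=
  ∀ t, 0 ≤ t → Tendsto (fun n : ℕ => Real.log ((S n).mgf t) / n) atTop (𝓝 (F t))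

variable {S : ∀ n, PinchedSpectrum (ρ n) (σ n)} {F : ℝ → ℝ}

namespace IsCGF

variable (hF : IsCGF S F)
include hF

theorem zero : F 0 = 0 := by
  refine tendsto_nhds_unique (hF 0 le_rfl) ?_
  simp [PinchedSpectrum.mgf_zero]

theorem nonneg {t : ℝ} (ht : 0 ≤ t) : 0 ≤ F t :=
  ge_of_tendsto' (hF t ht) fun n =>
    div_nonneg (Real.log_nonneg ((S n).one_le_mgf ht)) n.cast_nonneg

theorem convexOn : ConvexOn ℝ (Set.Ici 0) F := by
  refine ⟨convex_Ici 0, fun a ha b hb x y hx hy hxy => ?_⟩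
  have hab : 0 ≤ x * a + y * b := add_nonneg (mul_nonneg hx ha) (mul_nonneg hy hb)
  refine le_of_tendsto_of_tendsto' (hF _ hab)
    (((hF a ha).const_mul x).add ((hF b hb).const_mul y)) fun n => ?_
  have := (S n).convexOn_log_mgf.2 (Set.mem_univ a) (Set.mem_univ b) hx hy hxy
  simp only [smul_eq_mul] at this
  calc _ ≤ (x * Real.log ((S n).mgf a) + y * Real.log ((S n).mgf b)) / n :=
        div_le_div_of_nonneg_right this n.cast_nonneg
    _ = _ := by ring

theorem eventually_le_mgf {t ε : ℝ} (ht : 0 ≤ t) (hε : 0 < ε) :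
    ∀ᶠ n : ℕ in atTop, Real.exp (n * (F t - ε)) ≤ (S n).mgf t := by
  filter_upwards [(hF t ht).eventually (lt_mem_nhds (sub_lt_self (F t) hε)),
    eventually_gt_atTop 0] with n hn h0
  rw [← Real.le_log_iff_exp_le ((S n).mgf_pos t), mul_comm]
  exact ((lt_div_iff₀ (by exact_mod_cast h0)).1 hn).le

theorem eventually_mgf_le {t ε : ℝ} (ht : 0 ≤ t) (hε : 0 < ε) :
    ∀ᶠ n : ℕ in atTop, (S n).mgf t ≤ Real.exp (n * (F t + ε)) := by
  filter_upwards [(hF t ht).eventually (gt_mem_nhds (lt_add_of_pos_right (F t) hε)),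
    eventually_gt_atTop 0] with n hn h0
  rw [← Real.log_le_iff_le_exp ((S n).mgf_pos t), mul_comm]
  exact ((div_lt_iff₀ (by exact_mod_cast h0)).1 hn).le

theorem eventually_mass_p_le {t ε : ℝ} (ht : 0 ≤ t) (hε : 0 < ε) (a : ℝ) :
    ∀ᶠ n : ℕ in atTop,
      (S n).mass (S n).p (Set.Ioi (n * a)) ≤ Real.exp (n * (F t - t * a + ε)) := by
  filter_upwards [hF.eventually_mgf_le ht hε] with n hn
  refine ((S n).mass_p_Ioi_le ht _).trans ?_
  calc _ ≤ Real.exp (-(t * (n * a))) * Real.exp (n * (F t + ε)) :=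
        mul_le_mul_of_nonneg_left hn (Real.exp_pos _).le
    _ = _ := by rw [← Real.exp_add]; congr 1; ring

theorem eventually_mass_q_le {t ε : ℝ} (ht : 0 ≤ t) (hε : 0 < ε) (a : ℝ) :
    ∀ᶠ n : ℕ in atTop,
      (S n).mass (S n).q (Set.Ioi (n * a)) ≤ Real.exp (n * (F t - t * a - a + ε)) := by
  filter_upwards [hF.eventually_mass_p_le ht hε a] with n hn
  refine ((S n).mass_q_Ioi_le _).trans ?_
  calc _ ≤ Real.exp (-(n * a)) * Real.exp (n * (F t - t * a + ε)) :=
        mul_le_mul_of_nonneg_left hn (Real.exp_pos _).le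
    _ = _ := by rw [← Real.exp_add]; congr 1; ring

/-- The tilted distributions concentrate at the derivative of the cumulant generating function. -/
theorem eventually_le_mass_p {t a b c ε : ℝ} (ht : 0 < t) (hd : HasDerivAt F c t) (hac : a < c)
    (hcb : c < b) (hε : 0 < ε) : ∀ᶠ n : ℕ in atTop,
      Real.exp (n * (F t - t * b - ε)) ≤ (S n).mass (S n).p (Set.Ioo (n * a) (n * b)) := by
  obtain ⟨s, hs0, hst, hs1, hs2⟩ : ∃ s, 0 < s ∧ s < t ∧ F (t + s) - s * b < F t ∧
      F (t - s) + s * a < F t := by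
    have h1 := hasDerivAt_iff_tendsto_slope_zero.1 hd
    have hr : Tendsto (fun s => s⁻¹ • (F (t + s) - F t)) (𝓝[>] 0) (𝓝 c) :=
      h1.mono_left (nhdsWithin_mono _ fun x hx => ne_of_gt hx)
    have hl : Tendsto (fun s : ℝ => (-s)⁻¹ • (F (t + -s) - F t)) (𝓝[>] 0) (𝓝 c) := by
      refine h1.comp (tendsto_nhdsWithin_iff.2 ⟨?_, ?_⟩)
      · have : Tendsto (fun s : ℝ => -s) (𝓝 0) (𝓝 (-0)) := continuous_neg.tendsto 0
        rw [neg_zero] at this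
        exact this.mono_left nhdsWithin_le_nhds
      · filter_upwards [self_mem_nhdsWithin] with s hs
        exact (neg_lt_zero.2 hs).ne
    have hI : ∀ᶠ s in 𝓝[>] (0 : ℝ), s ∈ Set.Ioo 0 t := Ioo_mem_nhdsGT ht
    obtain ⟨s, h2, h3, hs0, hst⟩ := ((hr.eventually (gt_mem_nhds hcb)).and
      ((hl.eventually (lt_mem_nhds hac)).and hI)).exists
    refine ⟨s, hs0, hst, ?_, ?_⟩
    · rw [smul_eq_mul, inv_mul_lt_iff₀ hs0] at h2
      linarith
    · rw [smul_eq_mul, inv_neg, neg_mul, ← mul_neg, lt_inv_mul_iff₀ hs0, ← sub_eq_add_neg] at h3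
      linarith
  obtain ⟨δ, hδ, hδε, hδ1, hδ2⟩ : ∃ δ > 0, 2 * δ ≤ ε ∧ F (t + s) - s * b ≤ F t - 3 * δ ∧
      F (t - s) + s * a ≤ F t - 3 * δ := by
    refine ⟨min (ε / 2) (min ((F t - (F (t + s) - s * b)) / 3)
      ((F t - (F (t - s) + s * a)) / 3)), ?_, ?_, ?_, ?_⟩
    · refine lt_min (by linarith) (lt_min (by linarith) (by linarith))
    · linarith [min_le_left (ε / 2) (min ((F t - (F (t + s) - s * b)) / 3)
        ((F t - (F (t - s) + s * a)) / 3))]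
    · linarith [(min_le_right (ε / 2) (min ((F t - (F (t + s) - s * b)) / 3)
        ((F t - (F (t - s) + s * a)) / 3))).trans (min_le_left _ _)]
    · linarith [(min_le_right (ε / 2) (min ((F t - (F (t + s) - s * b)) / 3)
        ((F t - (F (t - s) + s * a)) / 3))).trans (min_le_right _ _)]
  have hexp : ∀ᶠ n : ℕ in atTop, Real.exp (-(n * δ)) ≤ 1 / 3 := by
    have : Tendsto (fun n : ℕ => Real.exp (-(n * δ))) atTop (𝓝 0) :=
      Real.tendsto_exp_neg_atTop_nhds_zero.comp
        (tendsto_natCast_atTop_atTop.atTop_mul_const hδ)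
    exact (this.eventually (gt_mem_nhds (by norm_num : (0 : ℝ) < 1 / 3))).mono fun _ h => h.le
  filter_upwards [hF.eventually_le_mgf ht.le hδ,
    hF.eventually_mgf_le (t := t + s) (by linarith) hδ,
    hF.eventually_mgf_le (t := t - s) (by linarith) hδ, hexp] with n h0 h1 h2 h3
  refine le_trans ?_ ((S n).le_mass_p_Ioo hs0.le ht.le _ _)
  have hn : (0 : ℝ) ≤ n := n.cast_nonneg
  have k1 : Real.exp (-(s * (n * b))) * (S n).mgf (t + s) ≤ Real.exp (n * (F t - 2 * δ)) := by
    refine (mul_le_mul_of_nonneg_left h1 (Real.exp_pos _).le).trans ?_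
    rw [← Real.exp_add]
    refine Real.exp_le_exp.2 ?_
    have := mul_le_mul_of_nonneg_left hδ1 hn
    linarith
  have k2 : Real.exp (s * (n * a)) * (S n).mgf (t - s) ≤ Real.exp (n * (F t - 2 * δ)) := by
    refine (mul_le_mul_of_nonneg_left h2 (Real.exp_pos _).le).trans ?_
    rw [← Real.exp_add]
    refine Real.exp_le_exp.2 ?_
    have := mul_le_mul_of_nonneg_left hδ2 hn
    linarith
  have k3 : Real.exp (n * (F t - 2 * δ)) =
      Real.exp (n * (F t - δ)) * Real.exp (-(n * δ)) := by
    rw [← Real.exp_add]; congr 1; ring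
  have k4 : Real.exp (n * (F t - ε)) ≤ Real.exp (n * (F t - 2 * δ)) :=
    Real.exp_le_exp.2 (mul_le_mul_of_nonneg_left (by linarith) hn)
  have k5 := mul_le_mul_of_nonneg_left h3 (Real.exp_pos (n * (F t - δ))).le
  have k6 : Real.exp (n * (F t - t * b - ε)) =
      Real.exp (-(t * (n * b))) * Real.exp (n * (F t - ε)) := by
    rw [← Real.exp_add]; congr 1; ring
  rw [k6]
  refine mul_le_mul_of_nonneg_left ?_ (Real.exp_pos _).le
  linarith

end IsCGF

end Sequences

section ConvexFunctions

variable {F : ℝ → ℝ}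

theorem tangent_le (hconv : ConvexOn ℝ (Set.Ici 0) F) {t c x : ℝ} (ht : 0 < t) (hx : 0 ≤ x)
    (hd : HasDerivAt F c t) : F t + c * (x - t) ≤ F x := by
  rcases lt_trichotomy x t with h | rfl | h
  · have := hconv.slope_le_of_hasDerivAt hx ht.le h hd
    rw [slope_def_field, div_le_iff₀ (sub_pos.2 h)] at this
    linarith
  · simp
  · have := hconv.le_slope_of_hasDerivAt ht.le hx h hd
    rw [slope_def_field, le_div_iff₀ (sub_pos.2 h)] at this
    linarith

theorem tendsto_zero_of_convexOn (hconv : ConvexOn ℝ (Set.Ici 0) F) (h0 : F 0 = 0)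
    (hnn : ∀ t, 0 ≤ t → 0 ≤ F t) : Tendsto F (𝓝[≥] 0) (𝓝 0) := by
  have h1 : Tendsto (fun t : ℝ => t * F 1) (𝓝[≥] 0) (𝓝 0) := by
    have : Tendsto (fun t : ℝ => t * F 1) (𝓝 0) (𝓝 (0 * F 1)) :=
      tendsto_id.mul_const (F 1)
    rw [zero_mul] at this
    exact this.mono_left nhdsWithin_le_nhds
  refine tendsto_of_tendsto_of_tendsto_of_le_of_le' tendsto_const_nhds h1 ?_ ?_
  · filter_upwards [self_mem_nhdsWithin] with t ht using hnn t ht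
  · filter_upwards [Icc_mem_nhdsGE (zero_lt_one' ℝ)] with t ht
    have := hconv.2 (Set.mem_Ici.2 le_rfl) (Set.mem_Ici.2 zero_le_one) (sub_nonneg.2 ht.2) ht.1
      (by ring : 1 - t + t = 1)
    simpa [h0] using this

theorem continuousOn_of_convexOn (hconv : ConvexOn ℝ (Set.Ici 0) F) (h0 : F 0 = 0)
    (hnn : ∀ t, 0 ≤ t → 0 ≤ F t) (hd : ∀ t, 0 < t → DifferentiableAt ℝ F t) :
    ContinuousOn F (Set.Ici 0) := by
  intro t ht
  rcases (Set.mem_Ici.1 ht).eq_or_lt with rfl | h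
  · rw [ContinuousWithinAt, h0]
    exact tendsto_zero_of_convexOn hconv h0 hnn
  · exact (hd t h).continuousAt.continuousWithinAt

/-- The slopes of `F` between its extreme secant slopes are attained as derivatives on a bounded
interval. -/
theorem exists_hasDerivAt_of_secants (hc : ContinuousOn F (Set.Ici 0)) (h0 : F 0 = 0)
    (hd : ∀ t, 0 < t → DifferentiableAt ℝ F t) {a t₁ t₂ : ℝ} (ht₁ : 0 < t₁) (ht₂ : 0 < t₂)
    (h₁ : F t₁ < a * t₁) (h₂ : a * t₂ < F t₂) :
    ∃ M > 0, ∃ d > a, ∀ c, a ≤ c → c ≤ d → ∃ t, 0 < t ∧ t ≤ M ∧ HasDerivAt F c t := by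
  have hmv : ∀ t, 0 < t → ∃ s, 0 < s ∧ deriv F s = F t / t := fun t ht => by
    obtain ⟨s, hs, h⟩ := exists_hasDerivAt_eq_slope F (deriv F) ht
      (hc.mono fun x hx => hx.1) fun x hx => (hd x hx.1).hasDerivAt
    exact ⟨s, hs.1, by simpa [h0] using h⟩
  obtain ⟨s₁, hs₁, e₁⟩ := hmv t₁ ht₁
  obtain ⟨s₂, hs₂, e₂⟩ := hmv t₂ ht₂
  have ho : Set.OrdConnected (deriv F '' Set.Ioc 0 (max s₁ s₂)) :=
    Set.ordConnected_Ioc.image_deriv fun x hx => hd x hx.1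
  refine ⟨max s₁ s₂, lt_max_of_lt_left hs₁, deriv F s₂, ?_, fun c hc1 hc2 => ?_⟩
  · rw [e₂]; exact (lt_div_iff₀ ht₂).2 h₂
  · have hlow : deriv F s₁ ≤ c := by
      rw [e₁]; exact ((div_lt_iff₀ ht₁).2 h₁).le.trans hc1
    obtain ⟨t, ht, rfl⟩ := ho.out (Set.mem_image_of_mem _ ⟨hs₁, le_max_left _ _⟩)
      (Set.mem_image_of_mem _ ⟨hs₂, le_max_right _ _⟩) ⟨hlow, hc2⟩
    exact ⟨t, ht.1, ht.2, (hd t ht.1).hasDerivAt⟩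

/-- If `x` is at most the sum of the Legendre transform `t F' - F` and of the excess of the rate
`r` over `(1 + t) F' - F`, for all `t`, then it is at most the supremum of
`(r t - F t) / (1 + t)`. -/
theorem le_iSup_of_forall_le_legendre (hconv : ConvexOn ℝ (Set.Ici 0) F) (h0 : F 0 = 0)
    (hnn : ∀ t, 0 ≤ t → 0 ≤ F t) (hd : ∀ t, 0 < t → DifferentiableAt ℝ F t) {r : ℝ}
    {x y : EReal}
    (hx : ∀ t, 0 < t → x ≤ ((t * deriv F t - F t +
      max 0 (r - ((1 + t) * deriv F t - F t)) : ℝ) : EReal))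
    (hy : ∀ t, 0 < t → (((r * t - F t) / (1 + t) : ℝ) : EReal) ≤ y) : x ≤ y := by
  set R : ℝ → ℝ := fun t => (1 + t) * deriv F t - F t with hR
  have hG : ∀ t, 0 < t → HasDerivAt (fun t => (r * t - F t) / (1 + t))
      ((r - R t) / (1 + t) ^ 2) t := fun t ht => by
    have h1 : HasDerivAt (fun t : ℝ => r * t - F t) (r - deriv F t) t := by
      have := ((hasDerivAt_id t).const_mul r).sub (hd t ht).hasDerivAt
      rwa [mul_one] at this
    have h2 : HasDerivAt (fun t : ℝ => 1 + t) 1 t := (hasDerivAt_id t).const_add 1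
    refine (h1.div h2 (by positivity)).congr_deriv ?_
    congr 1
    simp only [hR]; ring
  have hF0 := tendsto_zero_of_convexOn hconv h0 hnn
  have hF0' : Tendsto F (𝓝[>] 0) (𝓝 0) := hF0.mono_left (nhdsWithin_mono _ Set.Ioi_subset_Ici_self)
  by_cases hz : ∃ t, 0 < t ∧ R t = r
  · obtain ⟨t, ht, hRt⟩ := hz
    refine (hx t ht).trans (le_trans (EReal.coe_le_coe_iff.2 ?_) (hy t ht))
    have h1 : (1 + t) * deriv F t - F t = r := hRt
    rw [h1, sub_self, max_self, add_zero, le_div_iff₀ (by positivity), ← h1]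
    apply le_of_eq; ring
  · have ho : Set.OrdConnected
        ((fun t => (r - R t) / (1 + t) ^ 2) '' Set.Ioi (0 : ℝ)) :=
      Set.ordConnected_Ioi.image_hasDerivWithinAt fun t ht => (hG t ht).hasDerivWithinAt
    have hsign : (∀ t, 0 < t → r < R t) ∨ (∀ t, 0 < t → R t < r) := by
      by_contra hcon
      push Not at hcon
      obtain ⟨⟨t, ht, h1⟩, ⟨s, hs, h2⟩⟩ := hcon
      obtain ⟨u, hu, hu0⟩ := ho.out (Set.mem_image_of_mem _ hs) (Set.mem_image_of_mem _ ht)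
        (Set.mem_Icc.2 ⟨div_nonpos_of_nonpos_of_nonneg (sub_nonpos.2 h2) (by positivity),
          div_nonneg (sub_nonneg.2 h1) (by positivity)⟩)
      have hu' : 0 < u := hu
      refine hz ⟨u, hu', ?_⟩
      rcases div_eq_zero_iff.1 hu0 with h | h
      · linarith
      · exact absurd h (by positivity)
    rcases hsign with h | h
    · have hx0 : x ≤ ((0 : ℝ) : EReal) := by
        have hu : Tendsto (fun t => F (2 * t) - 2 * F t) (𝓝[>] 0) (𝓝 0) := by
          have h2 : Tendsto (fun t : ℝ => 2 * t) (𝓝[>] 0) (𝓝[>] 0) := by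
            refine tendsto_nhdsWithin_iff.2 ⟨?_, ?_⟩
            · have : Tendsto (fun t : ℝ => 2 * t) (𝓝 0) (𝓝 (2 * 0)) := tendsto_id.const_mul 2
              rw [mul_zero] at this
              exact this.mono_left nhdsWithin_le_nhds
            · filter_upwards [self_mem_nhdsWithin] with t ht
              exact mul_pos two_pos (Set.mem_Ioi.1 ht)
          simpa using (hF0'.comp h2).sub (hF0'.const_mul 2)
        refine ge_of_tendsto (EReal.tendsto_coe.2 hu) ?_
        filter_upwards [self_mem_nhdsWithin] with t ht
        have ht : 0 < t := ht
        refine (hx t ht).trans (EReal.coe_le_coe_iff.2 ?_)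
        have h3 : r < (1 + t) * deriv F t - F t := h t ht
        rw [max_eq_left (by linarith)]
        have := tangent_le hconv ht (by positivity : (0 : ℝ) ≤ 2 * t) (hd t ht).hasDerivAt
        linarith
      refine hx0.trans ?_
      have hG0 : Tendsto (fun t => (r * t - F t) / (1 + t)) (𝓝[>] 0) (𝓝 0) := by
        have h1 : Tendsto (fun t : ℝ => t) (𝓝[>] 0) (𝓝 0) := nhdsWithin_le_nhds
        have h2 := ((h1.const_mul r).sub hF0').div (h1.const_add 1) (by norm_num)
        rw [mul_zero, sub_zero, zero_div] at h2
        exact h2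
      refine le_of_tendsto (EReal.tendsto_coe.2 hG0) ?_
      filter_upwards [self_mem_nhdsWithin] with t ht using hy t ht
    · induction y with
      | top => exact le_top
      | bot => exact absurd (hy 1 one_pos) (by simp)
      | coe y =>
        have hlim : Tendsto (fun t : ℝ => y + r / (1 + t)) atTop (𝓝 y) := by
          have h1 : Tendsto (fun t : ℝ => r / (1 + t)) atTop (𝓝 0) :=
            (tendsto_atTop_add_const_left _ _ tendsto_id).const_div_atTop r
          simpa using h1.const_add y
        refine ge_of_tendsto (EReal.tendsto_coe.2 hlim) ?_
        filter_upwards [eventually_gt_atTop 0] with t ht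
        refine (hx t ht).trans (EReal.coe_le_coe_iff.2 ?_)
        have h3 : (1 + t) * deriv F t - F t < r := h t ht
        have h4 := EReal.coe_le_coe_iff.1 (hy t ht)
        rw [max_eq_right (by linarith)]
        have h5 := tangent_le hconv ht le_rfl (hd t ht).hasDerivAt
        rw [h0] at h5
        have h6 : 0 ≤ deriv F t := by
          have : 0 ≤ t * deriv F t := by linarith [hnn t ht.le]
          exact nonneg_of_mul_nonneg_right this ht
        have h7 : r - deriv F t ≤ (r * t - F t) / (1 + t) + r / (1 + t) := by
          rw [← add_div, le_div_iff₀ (by positivity)]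
          linarith
        linarith

end ConvexFunctions

section LogRate

variable {u : ℕ → ℝ} {x : ℝ}

theorem logRate_le_coe_iff {n : ℕ} (hn : 0 < n) :
    logRate u n ≤ (x : EReal) ↔ u n ≤ Real.exp (n * x) := by
  have hn' : (0 : ℝ) < n := by exact_mod_cast hn
  rw [logRate, EReal.div_le_iff_le_mul (by exact_mod_cast hn') (EReal.coe_ne_top _),
    ← EReal.coe_mul, ENNReal.log_ofReal]
  split_ifs with h
  · simp only [bot_le, true_iff]
    exact h.trans (Real.exp_pos _).le
  · rw [EReal.coe_le_coe_iff, Real.log_le_iff_le_exp (not_le.1 h)]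

theorem coe_le_logRate_iff {n : ℕ} (hn : 0 < n) :
    (x : EReal) ≤ logRate u n ↔ Real.exp (n * x) ≤ u n := by
  have hn' : (0 : ℝ) < n := by exact_mod_cast hn
  rw [logRate, EReal.le_div_iff_mul_le (by exact_mod_cast hn') (EReal.coe_ne_top _),
    ← EReal.coe_mul, ENNReal.log_ofReal]
  split_ifs with h
  · simp only [le_bot_iff, EReal.coe_ne_bot, false_iff, not_le]
    exact h.trans_lt (Real.exp_pos _)
  · rw [EReal.coe_le_coe_iff, Real.le_log_iff_exp_le (not_le.1 h), mul_comm]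

theorem limsup_logRate_le (h : ∀ᶠ n : ℕ in atTop, u n ≤ Real.exp (n * x)) :
    limsup (logRate u) atTop ≤ (x : EReal) := by
  refine limsup_le_of_le (by isBoundedDefault) ?_
  filter_upwards [h, eventually_gt_atTop 0] with n h1 h2
  exact (logRate_le_coe_iff h2).2 h1

theorem le_liminf_logRate (h : ∀ᶠ n : ℕ in atTop, Real.exp (n * x) ≤ u n) :
    (x : EReal) ≤ liminf (logRate u) atTop := by
  refine le_liminf_of_le (by isBoundedDefault) ?_
  filter_upwards [h, eventually_gt_atTop 0] with n h1 h2
  exact (coe_le_logRate_iff h2).2 h1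

theorem eventually_le_of_limsup_logRate_lt (h : limsup (logRate u) atTop < (x : EReal)) :
    ∀ᶠ n : ℕ in atTop, u n ≤ Real.exp (n * x) := by
  filter_upwards [eventually_lt_of_limsup_lt h, eventually_gt_atTop 0] with n h1 h2
  exact (logRate_le_coe_iff h2).1 h1.le

theorem eventually_le_of_lt_liminf_logRate (h : (x : EReal) < liminf (logRate u) atTop) :
    ∀ᶠ n : ℕ in atTop, Real.exp (n * x) ≤ u n := by
  filter_upwards [eventually_lt_of_lt_liminf h, eventually_gt_atTop 0] with n h1 h2
  exact (coe_le_logRate_iff h2).1 h1.le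

theorem logRate_eq_coe {n : ℕ} (h : 0 < u n) :
    logRate u n = ((Real.log (u n) / n : ℝ) : EReal) := by
  rw [logRate, ENNReal.log_ofReal_of_pos h, EReal.coe_div]

theorem coe_le_of_forall_sub {C : ℝ} {z : EReal}
    (h : ∀ ε > 0, ((x - C * ε : ℝ) : EReal) ≤ z) : (x : EReal) ≤ z := by
  have hl : Tendsto (fun ε : ℝ => x - C * ε) (𝓝[>] 0) (𝓝 x) := by
    have : Tendsto (fun ε : ℝ => x - C * ε) (𝓝 0) (𝓝 (x - C * 0)) :=
      (tendsto_id.const_mul C).const_sub x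
    rw [mul_zero, sub_zero] at this
    exact this.mono_left nhdsWithin_le_nhds
  refine le_of_tendsto (EReal.tendsto_coe.2 hl) ?_
  filter_upwards [self_mem_nhdsWithin] with ε hε using h ε hε

theorem le_coe_of_forall_add {C : ℝ} {z : EReal}
    (h : ∀ ε > 0, z ≤ ((x + C * ε : ℝ) : EReal)) : z ≤ (x : EReal) := by
  have hl : Tendsto (fun ε : ℝ => x + C * ε) (𝓝[>] 0) (𝓝 x) := by
    have : Tendsto (fun ε : ℝ => x + C * ε) (𝓝 0) (𝓝 (x + C * 0)) :=
      (tendsto_id.const_mul C).const_add x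
    rw [mul_zero, add_zero] at this
    exact this.mono_left nhdsWithin_le_nhds
  refine ge_of_tendsto (EReal.tendsto_coe.2 hl) ?_
  filter_upwards [self_mem_nhdsWithin] with ε hε using h ε hε

theorem tendsto_logRate (hl : ∀ ε > 0, ∀ᶠ n : ℕ in atTop, Real.exp (n * (x - ε)) ≤ u n)
    (hu : ∀ ε > 0, ∀ᶠ n : ℕ in atTop, u n ≤ Real.exp (n * (x + ε))) :
    Tendsto (logRate u) atTop (𝓝 (x : EReal)) := by
  refine tendsto_of_le_liminf_of_limsup_le ?_ ?_ (by isBoundedDefault) (by isBoundedDefault)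
  · refine coe_le_of_forall_sub (C := 1) fun ε hε => ?_
    rw [one_mul]
    exact le_liminf_logRate (hl ε hε)
  · refine le_coe_of_forall_add (C := 1) fun ε hε => ?_
    rw [one_mul]
    exact limsup_logRate_le (hu ε hε)

end LogRate

section StrongConverse

variable {ι : ℕ → Type*} [∀ n, Fintype (ι n)] [∀ n, DecidableEq (ι n)]
  {ρ σ : ∀ n, Matrix (ι n) (ι n) ℂ}

theorem tr_mul_SHat (S : ∀ n, PinchedSpectrum (ρ n) (σ n)) (a : ℝ) (n : ℕ) :
    tr (ρ n * SHat ρ σ a n) = (S n).mass (S n).p (Set.Ioi (n * a)) ∧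
    tr (σ n * SHat ρ σ a n) = (S n).mass (S n).q (Set.Ioi (n * a)) := by
  rw [SHat, (S n).specProj_eq_windowTest, (S n).tr_left_windowTest, (S n).tr_right_windowTest,
    one_mul, one_mul]
  exact ⟨rfl, rfl⟩

theorem isCGF_of_tendsto_psiHatSeq (S : ∀ n, PinchedSpectrum (ρ n) (σ n)) {g : ℝ → ℝ}
    (hlim : ∀ α : ℝ, 1 < α → Tendsto (psiHatSeq ρ σ α) atTop (𝓝 (g α : EReal))) :
    IsCGF S fun t => if 0 < t then g (1 + t) else 0 := by
  intro t ht
  rcases ht.eq_or_lt with rfl | h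
  · simp [PinchedSpectrum.mgf_zero]
  · simp only [h, if_true]
    rw [← EReal.tendsto_coe]
    refine (hlim (1 + t) (by linarith)).congr fun n => ?_
    have h1 : Q (1 + t) (pinching (σ n) (ρ n)) (σ n) = (S n).mgf t := (S n).Q_eq_mgf t
    rw [psiHatSeq, logRate_eq_coe (by rw [h1]; exact (S n).mgf_pos t), h1]

/-- The converse bound for a single sequence of tests. -/
theorem antiDiv_le_neg_liminf (hρ : ∀ n, IsState (ρ n)) (hσ : ∀ n, IsState (σ n))
    (hsupp : ∀ n, supp (ρ n) ≤ supp (σ n)) {r : ℝ} {T : ∀ n, Matrix (ι n) (ι n) ℂ}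
    (hT : ∀ n, IsTest (T n))
    (hr : limsup (logRate (fun n => tr (σ n * T n))) atTop ≤ ((-r : ℝ) : EReal)) :
    H ρ σ r ≤ -liminf (logRate (fun n => tr (ρ n * T n))) atTop := by
  refine iSup₂_le fun α hα => ?_
  have hα : 1 < α := hα
  have hα0 : 0 < α := by linarith
  refine EReal.le_neg_of_le_neg (le_of_forall_lt fun c hc => ?_)
  obtain ⟨y, hcy, hy⟩ := EReal.lt_iff_exists_real_btwn.1 hc
  refine hcy.trans_le (EReal.le_neg_of_le_neg ?_)
  have hψ : ((α * y + (α - 1) * r : ℝ) : EReal) ≤ psiBar ρ σ α := by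
    refine coe_le_of_forall_sub (C := α - 1) fun ε hε => ?_
    refine le_trans ?_ liminf_le_limsup
    refine le_liminf_logRate ?_
    have hr' : limsup (logRate (fun n => tr (σ n * T n))) atTop < ((-r + ε : ℝ) : EReal) :=
      hr.trans_lt (EReal.coe_lt_coe_iff.2 (by linarith))
    filter_upwards [eventually_le_of_lt_liminf_logRate hy,
      eventually_le_of_limsup_logRate_lt hr'] with n h1 h2
    have hQ := Qstar_nonneg (hρ n).1 (hσ n).1 α
    have h3 := h1.trans (tr_mul_test_le (hρ n).1 (hσ n).1 (hsupp n) (hT n) hα)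
    have h4 : tr (σ n * T n) ^ ((α - 1) / α) ≤ Real.exp (n * (-r + ε)) ^ ((α - 1) / α) :=
      Real.rpow_le_rpow (tr_mul_nonneg (hσ n).1 (hT n).1) h2
        (div_nonneg (by linarith) hα0.le)
    have h5 := h3.trans (mul_le_mul_of_nonneg_left h4 (Real.rpow_nonneg hQ (1 / α)))
    rw [← Real.exp_mul] at h5
    have h6 : Real.exp (n * y - n * (-r + ε) * ((α - 1) / α)) ≤
        Qstar α (ρ n) (σ n) ^ (1 / α) := by
      rw [Real.exp_sub, div_le_iff₀ (Real.exp_pos _)]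
      exact h5
    have h7 := Real.rpow_le_rpow (Real.exp_pos _).le h6 hα0.le
    rw [← Real.rpow_mul hQ, one_div_mul_cancel hα0.ne', Real.rpow_one, ← Real.exp_mul] at h7
    refine le_trans (le_of_eq ?_) h7
    congr 1
    field_simp
    ring
  calc _ ≤ (((r * (α - 1) : ℝ) : EReal) - ((α * y + (α - 1) * r : ℝ) : EReal)) / (α : EReal) :=
        EReal.div_le_div_right_of_nonneg (by exact_mod_cast hα0.le)
          (EReal.sub_le_sub le_rfl hψ)
    _ = ((-y : ℝ) : EReal) := by
        rw [← EReal.coe_sub, ← EReal.coe_div]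
        congr 1
        field_simp
        ring
    _ = -(y : EReal) := EReal.coe_neg y

variable {S : ∀ n, PinchedSpectrum (ρ n) (σ n)} {F : ℝ → ℝ}

/-- The strong converse exponent achieved by the pinched window tests around a derivative of the
cumulant generating function, scaled down when the rate is too small. -/
theorem IsCGF.sc_le (hF : IsCGF S F) {t c : ℝ} (ht : 0 < t) (hd : HasDerivAt F c t) (r : ℝ) :
    sc ρ σ r ≤ ((t * c - F t + max 0 (r - ((1 + t) * c - F t)) : ℝ) : EReal) := by
  refine le_coe_of_forall_add (C := 2 * t + 3) fun ε hε => ?_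
  set m := max 0 (r - ((1 + t) * c - F t)) + (t + 2) * ε with hm
  have hm0 : 0 ≤ m := by positivity
  have hm1 : r - ((1 + t) * c - F t) + (t + 2) * ε ≤ m :=
    add_le_add_left (le_max_right _ _) _
  let T : ∀ n, Matrix (ι n) (ι n) ℂ := fun n =>
    (S n).windowTest (Set.Ioo (n * (c - ε)) (n * (c + ε))) (Real.exp (-(n * m)))
  have hσT : limsup (logRate (fun n => tr (σ n * T n))) atTop ≤ ((-r : ℝ) : EReal) := by
    refine limsup_logRate_le ?_
    filter_upwards [hF.eventually_mass_q_le ht.le hε (c - ε)] with n hn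
    have h0 : Set.Ioo (n * (c - ε)) (n * (c + ε)) ⊆ Set.Ioi (n * (c - ε)) :=
      Set.Ioo_subset_Ioi_self
    have h1 := ((S n).mass_mono (S n).q_nonneg h0).trans hn
    rw [(S n).tr_right_windowTest]
    refine (mul_le_mul_of_nonneg_left h1 (Real.exp_pos _).le).trans ?_
    rw [← Real.exp_add]
    refine Real.exp_le_exp.2 ?_
    have := mul_le_mul_of_nonneg_left hm1 (n.cast_nonneg (α := ℝ))
    linarith
  have hρT : ((F t - t * (c + ε) - ε - m : ℝ) : EReal) ≤
      liminf (logRate (fun n => tr (ρ n * T n))) atTop := by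
    refine le_liminf_logRate ?_
    filter_upwards [hF.eventually_le_mass_p ht hd (sub_lt_self c hε) (lt_add_of_pos_right c hε) hε]
      with n hn
    rw [(S n).tr_left_windowTest]
    refine le_trans (le_of_eq ?_) (mul_le_mul_of_nonneg_left hn (Real.exp_pos _).le)
    rw [← Real.exp_add]
    congr 1
    ring
  have hT : ∀ n, IsTest (T n) := fun n => (S n).isTest_windowTest _ (Real.exp_pos _).le
    (Real.exp_le_one_iff.2 (neg_nonpos.2 (mul_nonneg n.cast_nonneg hm0)))
  have hsc : sc ρ σ r ≤ -liminf (logRate (fun n => tr (ρ n * T n))) atTop :=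
    sInf_le ⟨T, hT, hσT, rfl⟩
  refine hsc.trans ?_
  refine (EReal.neg_le_neg_iff.2 hρT).trans (le_of_eq ?_)
  rw [← EReal.coe_neg]
  congr 1
  rw [hm]
  ring

/-- The lower bound for the error probabilities of threshold tests. -/
theorem IsCGF.eventually_le_mass_Ioi (hF : IsCGF S F) {a M d φ : ℝ} (hM : 0 < M) (had : a < d)
    (hMd : ∀ c, a ≤ c → c ≤ d → ∃ t, 0 < t ∧ t ≤ M ∧ HasDerivAt F c t)
    (hφ : ∀ t, 0 < t → a * t - F t ≤ φ) {ε : ℝ} (hε : 0 < ε) :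
    ∀ᶠ n : ℕ in atTop,
      Real.exp (n * (-φ - ε)) ≤ (S n).mass (S n).p (Set.Ioi (n * a)) ∧
      Real.exp (n * (-(φ + a) - ε)) ≤ (S n).mass (S n).q (Set.Ioi (n * a)) := by
  obtain ⟨η, hη, hηd, hηε⟩ : ∃ η > 0, a + η ≤ d ∧ 2 * η * (M + 1) ≤ ε / 2 := by
    refine ⟨min (d - a) (ε / (4 * (M + 1))), lt_min (by linarith) (by positivity), ?_, ?_⟩
    · linarith [min_le_left (d - a) (ε / (4 * (M + 1)))]
    · have := min_le_right (d - a) (ε / (4 * (M + 1)))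
      rw [le_div_iff₀ (by positivity)] at this
      linarith
  obtain ⟨t, ht, htM, hd⟩ := hMd (a + η) (by linarith) hηd
  have hφt := hφ t ht
  have hηt : η * t ≤ η * M := mul_le_mul_of_nonneg_left htM hη.le
  filter_upwards [hF.eventually_le_mass_p (a := a) (b := a + 2 * η) (ε := ε / 2) ht hd
    (by linarith) (by linarith) (by linarith)] with n hn
  have hn0 : (0 : ℝ) ≤ n := n.cast_nonneg
  have hsub : Set.Ioo (n * a) (n * (a + 2 * η)) ⊆ Set.Ioi (n * a) := Set.Ioo_subset_Ioi_self
  constructor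
  · refine le_trans ?_ ((hn.trans ((S n).mass_mono (S n).p_nonneg hsub)))
    refine Real.exp_le_exp.2 (mul_le_mul_of_nonneg_left ?_ hn0)
    linarith
  · refine le_trans ?_ (((S n).le_mass_q_Ioo _ _).trans ((S n).mass_mono (S n).q_nonneg hsub))
    refine le_trans ?_ (mul_le_mul_of_nonneg_left hn (Real.exp_pos _).le)
    rw [← Real.exp_add]
    refine Real.exp_le_exp.2 ?_
    have : -(φ + a) - ε ≤ -(a + 2 * η) + (F t - t * (a + 2 * η) - ε / 2) := by linarith
    have := mul_le_mul_of_nonneg_left this hn0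
    linarith

end StrongConverse

end QHT

end

theorem mainTheorem2 {ι : ℕ → Type*} [∀ n, Fintype (ι n)] [∀ n, DecidableEq (ι n)]
    (ρ σ : ∀ n, Matrix (ι n) (ι n) ℂ)
    (hρ : ∀ n, QHT.IsState (ρ n)) (hσ : ∀ n, QHT.IsState (σ n))
    (hsupp : ∀ n, QHT.supp (ρ n) ≤ QHT.supp (σ n))
    (hlim : ∀ α : ℝ, 1 < α →
      Tendsto (QHT.psiHatSeq ρ σ α) atTop (𝓝 (QHT.psiHat ρ σ α)))
    (hdiff : ∃ g : ℝ → ℝ, (∀ α : ℝ, 1 < α → QHT.psiHat ρ σ α = (g α : EReal)) ∧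
      DifferentiableOn ℝ g (Set.Ioi 1)) :
    (∀ a : ℝ, QHT.DHatOne ρ σ < (a : EReal) → (a : EReal) < QHT.DHatInfty ρ σ →
      Tendsto (QHT.logRate (fun n => QHT.tr (σ n * QHT.SHat ρ σ a n))) atTop
        (𝓝 (-(QHT.phiHat ρ σ a + (a : EReal)))) ∧
      Tendsto (QHT.logRate (fun n => QHT.tr (ρ n * QHT.SHat ρ σ a n))) atTop
        (𝓝 (-QHT.phiHat ρ σ a))) ∧
    (∀ r : ℝ, 0 ≤ r → QHT.H ρ σ r ≤ QHT.sc ρ σ r ∧ QHT.sc ρ σ r ≤ QHT.HHat ρ σ r) ∧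
    ((∀ α : ℝ, 1 < α → QHT.psiBar ρ σ α = QHT.psiHat ρ σ α) →
      ∀ r : ℝ, 0 ≤ r → QHT.sc ρ σ r = QHT.H ρ σ r) := by
  obtain ⟨g, hg, hgd⟩ := hdiff
  let S : ∀ n, QHT.PinchedSpectrum (ρ n) (σ n) := fun n =>
    (QHT.nonempty_pinchedSpectrum (hρ n) (hσ n) (hsupp n)).some
  let F : ℝ → ℝ := fun t => if 0 < t then g (1 + t) else 0
  have hFg : ∀ t, 0 < t → F t = g (1 + t) := fun t ht => if_pos ht
  have hF : QHT.IsCGF S F :=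
    QHT.isCGF_of_tendsto_psiHatSeq S fun α hα => by rw [← hg α hα]; exact hlim α hα
  have hd : ∀ t, 0 < t → DifferentiableAt ℝ F t := fun t ht => by
    have h1 : DifferentiableAt ℝ g (1 + t) :=
      hgd.differentiableAt (Ioi_mem_nhds (by linarith))
    have h2 : DifferentiableAt ℝ (fun t => g (1 + t)) t :=
      h1.comp t ((differentiableAt_id).const_add 1)
    refine h2.congr_of_eventuallyEq ?_
    filter_upwards [Ioi_mem_nhds ht] with s hs using hFg s hs
  have hconv := hF.convexOn
  have hnn : ∀ t, 0 ≤ t → 0 ≤ F t := fun t => hF.nonneg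
  have hbounds : ∀ r : ℝ, QHT.H ρ σ r ≤ QHT.sc ρ σ r ∧ QHT.sc ρ σ r ≤ QHT.HHat ρ σ r := by
    refine fun r => ⟨le_sInf ?_, ?_⟩
    · rintro x ⟨T, hT, hr, rfl⟩
      exact QHT.antiDiv_le_neg_liminf hρ hσ hsupp hT hr
    · refine QHT.le_iSup_of_forall_le_legendre (r := r) hconv hF.zero hnn hd
        (fun t ht => hF.sc_le ht (hd t ht).hasDerivAt r) fun t ht => ?_
      have h1 : (1 : ℝ) < 1 + t := by linarith
      refine le_trans (le_of_eq ?_) (le_iSup₂ (1 + t) h1)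
      rw [hg _ h1, ← hFg t ht, ← EReal.coe_sub, ← EReal.coe_div, add_sub_cancel_left]
  refine ⟨fun a ha₁ ha₂ => ?_, fun r _ => hbounds r, fun heq r _ => ?_⟩
  · obtain ⟨α₁, hα₁, h₁⟩ : ∃ α, 1 < α ∧ QHT.DHat ρ σ α < a := by
      simpa [QHT.DHatOne, iInf_lt_iff] using ha₁
    obtain ⟨α₂, hα₂, h₂⟩ : ∃ α, 1 < α ∧ (a : EReal) < QHT.DHat ρ σ α := by
      simpa [QHT.DHatInfty, lt_iSup_iff] using ha₂
    rw [QHT.DHat, hg _ hα₁, ← EReal.coe_div, EReal.coe_lt_coe_iff,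
      div_lt_iff₀ (sub_pos.2 hα₁)] at h₁
    rw [QHT.DHat, hg _ hα₂, ← EReal.coe_div, EReal.coe_lt_coe_iff,
      lt_div_iff₀ (sub_pos.2 hα₂)] at h₂
    obtain ⟨M, hM, d, had, hMd⟩ := QHT.exists_hasDerivAt_of_secants
      (QHT.continuousOn_of_convexOn hconv hF.zero hnn hd) hF.zero hd (a := a)
      (sub_pos.2 hα₁) (sub_pos.2 hα₂)
      (by rw [hFg _ (sub_pos.2 hα₁), add_sub_cancel]; exact h₁)
      (by rw [hFg _ (sub_pos.2 hα₂), add_sub_cancel]; exact h₂)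
    obtain ⟨t, ht, -, hdt⟩ := hMd a le_rfl had.le
    set φ := a * t - F t with hφ
    have hφle : ∀ s, 0 < s → a * s - F s ≤ φ := fun s hs => by
      have := QHT.tangent_le hconv ht hs.le hdt
      linarith
    have hphi : QHT.phiHat ρ σ a = (φ : EReal) := by
      refine le_antisymm (iSup₂_le fun α hα => ?_) ?_
      · have hα : 1 < α := hα
        rw [hg α hα, ← EReal.coe_sub, EReal.coe_le_coe_iff]
        have := hφle (α - 1) (sub_pos.2 hα)
        rwa [hFg _ (sub_pos.2 hα), add_sub_cancel] at this
      · have h1 : (1 : ℝ) < 1 + t := by linarith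
        refine le_trans (le_of_eq ?_) (le_iSup₂ (1 + t) h1)
        rw [hg _ h1, ← hFg t ht, ← EReal.coe_sub, add_sub_cancel_left]
    rw [hphi, ← EReal.coe_add, ← EReal.coe_neg, ← EReal.coe_neg]
    constructor
    · refine QHT.tendsto_logRate (fun ε hε => ?_) fun ε hε => ?_
      · filter_upwards [hF.eventually_le_mass_Ioi hM had hMd hφle hε] with n hn
        rw [(QHT.tr_mul_SHat S a n).2]
        exact hn.2
      · filter_upwards [hF.eventually_mass_q_le ht.le hε a] with n hn
        rw [(QHT.tr_mul_SHat S a n).2]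
        refine hn.trans (le_of_eq ?_)
        rw [hφ]
        congr 2
        ring
    · refine QHT.tendsto_logRate (fun ε hε => ?_) fun ε hε => ?_
      · filter_upwards [hF.eventually_le_mass_Ioi hM had hMd hφle hε] with n hn
        rw [(QHT.tr_mul_SHat S a n).1]
        exact hn.1
      · filter_upwards [hF.eventually_mass_p_le ht.le hε a] with n hn
        rw [(QHT.tr_mul_SHat S a n).1]
        refine hn.trans (le_of_eq ?_)
        rw [hφ]
        congr 2
        ring
  · refine le_antisymm ((hbounds r).2.trans (le_of_eq ?_)) (hbounds r).1
    exact (biSup_congr fun α hα => by rw [heq α hα])
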